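/- **Notation.** $|\cdot|$ is the Euclidean norm, $\mathbb R^+=[0,\infty)$, and for $r\ge 0$, $C^0_r:=C^0([-r,0];\mathbb R^n)$ carries the norm $\|x\|_r=\max_{\theta\in[-r,0]}|x(\theta)|$; $T_r(t)x:=x(t+\cdot)|_{[-r,0]}$ is the $r$-history of $x$ at time $t$. $K^+$ is the class of positive continuous functions on $\mathbb R^+$; $\mathcal N$ the class of non-decreasing $\gamma:\mathbb R^+\to\mathbb R^+$ with $\gamma(0)=0$; $K$ the class of continuous, strictly increasing $a:\mathbb R^+\to\mathbb R^+$ with $a(0)=0$; $K_\infty$ the unbounded members of $K$; $KL$ the class of continuous $\sigma:\mathbb R^+\times\mathbb R^+\to\mathbb R^+$ with $\sigma(\cdot,t)\in K$ for each $t$, and $\sigma(s,\cdot)$ non-increasing with limit $0$ at $+\infty$ for each $s$. $L^\infty_{loc}(\mathbb R^+;S)$ is the set of measurable, locally bounded functions $\mathbb R^+\to S$. **System.** Let $r\ge0$, let $D\subseteq\mathbb R^l$ be non-empty, and let $U\subseteq\mathbb R^m$, $S_1\subseteq\mathbb R^{k_1}$, $S_2\subseteq\mathbb R^{k}$ each contain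 $0$. Consider $$\dot x(t)=f(t,d(t),T_r(t)x,u(t),v(t))\ \text{ (a.e.)},\qquad Y(t)=H(t,T_r(t)x),\tag{S}$$ with inputs $v\in L^\infty_{loc}(\mathbb R^+;S_2)$, $u\in L^\infty_{loc}(\mathbb R^+;U)$, $d\in L^\infty_{loc}(\mathbb R^+;D)$, where $f:\mathbb R^+\times D\times C^0_r\times U\times S_2\to\mathbb R^n$ and $H:\mathbb R^+\times C^0_r\to S_1$ satisfy: * $H$ is continuous, maps bounded sets to bounded sets, and $H(t,0)=0$ for all $t\ge0$; * there are $\bar\beta\in K^+$, $a\in K_\infty$ with $|f(t,d,x,u,v)|\le a(\bar\beta(t)\|x\|_r)+a(\bar\beta(t)|u|)+a(\bar\beta(t)|v|)$ for all $(t,d,x,u,v)$; * for each $t\geq 0$, $(x,u,v,d)\mapsto f(t,d,x,u,v)$ is continuous, and for all bounded $I\subset\mathbb R^+$, $\Omega\subset C^0_r\times U\times S_2$ there is $L\ge0$ with $(x(0)-y(0))'(f(t,d,x,u,v)-f(t,d,y,u,v))\le L\|x-y\|_r^2$ for all $t\in I$, $d\in D$, $(x,u,v),(y,u,v)\in\Omega$;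 * there is a set $A\subset\mathbb R^+$, finite or consisting of the terms of a strictly increasing sequence of positive reals tending to $+\infty$, such that $f$ is jointly continuous on $(\mathbb R^+\setminus A)\times D\times C^0_r\times U\times S_2$; and $\lim_{t\to t_0^+}f(t,d,x,u,v)=f(t_0,d,x,u,v)$ for all $t_0\geq 0$ and all fixed $(d,x,u,v)$. A solution of (S) on $[t_0,\infty)$ with $T_r(t_0)x=x_0\in C^0_r$ is a continuous $x:[t_0-r,\infty)\to\mathbb R^n$ with this initial history, absolutely continuous on $[t_0,T]$ for every $T\geq t_0$, satisfying the differential equation for almost every $t\ge t_0$. (Under the above hypotheses it is unique when it exists.) **Functionals.** For $V:\mathbb R^+\times C^0_r\to\mathbb R^+$ and $w\in\mathbb R^n$ put $$V^0(t,x;w):=\limsup_{h\to0^+,\;y\to0\text{ in }C^0_r}\frac{V(t+h,E_h(x;w)+hy)-V(t,x)}{h}\in[-\infty,\infty],$$ where $E_h(x;w)(\theta)=x(0)+(\theta+h)w$ for $-h<\theta\le0$ and $E_h(x;w)(\theta)=x(\theta+h)$ for $-r\le\theta\le-h$. A continuous $V$ is *almost Lipschitz on bounded sets* if there are non-decreasing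 $M,P:\mathbb R^+\to\mathbb R^+$ and $G:\mathbb R^+\to[1,\infty)$ such that for all $R\ge0$ and $t\in[0,R]$: (1) $|V(t,y)-V(t,x)|\le M(R)\|y-x\|_r$ whenever $\|x\|_r,\|y\|_r\le R$; (2) for every absolutely continuous $x$ with $\|x\|_r\le R$ and $s:=\operatorname{ess\,sup}_{[-r,0]}|\dot x|<\infty$, $|V(t+h,x)-V(t,x)|\le hP(R)(1+s)$ for $0\le h\le 1/G(R+s)$. **Theorem.** Let $V:\mathbb R^+\times C^0_r\to\mathbb R^+$ be continuous and almost Lipschitz on bounded sets, and suppose there are $a_2\in K_\infty$, $\zeta,\zeta^u\in\mathcal N$, $\beta,\delta_1,\delta_1^u\in K^+$ and a continuous $\rho:\mathbb R^+\to\mathbb R^+$ with $\rho(0)=0$, $\rho(s)>0$ for $s>0$, such that $$V(t,x)\le a_2(\beta(t)\|x\|_r)\quad\text{for all }(t,x)\in\mathbb R^+\times C^0_r,$$ $$\max\{\zeta(\delta_1(t)|v|),\zeta^u(\delta_1^u(t)|u|)\}\le V(t,x)\ \Longrightarrow\ V^0(t,x;f(t,d,x,u,v))\le-\rho(V(t,x))$$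 for all $(t,x,u,v,d)\in\mathbb R^+\times C^0_r\times U\times S_2\times D$. For $\phi,\mu_1,c_1\in K^+$ and $g_1,p_1,p_1^u\in\mathcal N$ let (G) denote the estimate $$\phi(t)\|T_r(t)x\|_r\le\max\Big\{\mu_1(t-t_0),\,c_1(t_0),\,g_1(\|x_0\|_r),\,\sup_{t_0\le\tau\le t}p_1(|v(\tau)|),\,\sup_{t_0\le\tau\le t}p_1^u(\delta_1^u(\tau)|u(\tau)|)\Big\}$$ for all $t_0\ge0$, $x_0\in C^0_r$, all inputs $(v,u,d)$, the corresponding solution $x$ of (S) with $T_r(t_0)x=x_0$, and all $t\ge t_0$. 1. Suppose that for some $a_1\in K_\infty$, $a_1(|H(t,x)|)\le V(t,x)$ for all $(t,x)\in\mathbb R^+\times C^0_r$, that for all $t_0\geq 0$, $x_0\in C^0_r$ and all inputs the solution exists for all $t\ge t_0$, and that (G) holds for some $\phi,\mu_1,c_1\in K^+$, $g_1,p_1,p_1^u\in\mathcal N$. Then there is $\sigma_1\in KL$ such that for all $t_0\geq 0$, $x_0\in C^0_r$, all inputs $(v,u,d)$, the corresponding solution and all $t\ge t_0$ $$|H(t,T_r(t)x)|\le\sigma_1(\beta(t_0)\|x_0\|_r,t-t_0)+\sup_{t_0\le\tau\le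 t}a_1^{-1}\big(\zeta(\delta_1(\tau)|v(\tau)|)\big)+\sup_{t_0\le\tau\le t}a_1^{-1}\big(\zeta^u(\delta_1^u(\tau)|u(\tau)|)\big).$$ 2. Suppose that for some $p\in K_\infty$, $\mu\in K^+$ and $R\ge0$, $p(\mu(t)|x(0)|)\le V(t,x)+R$ for all $(t,x)\in\mathbb R^+\times C^0_r$, and that $\delta_1\equiv1$. Then for all $t_0\ge0$, $x_0\in C^0_r$ and all inputs the solution exists for all $t\ge t_0$, and for every $\phi\in K^+$ there are $\mu_1,c_1\in K^+$, $g_1,p_1,p_1^u\in\mathcal N$ such that (G) holds. Moreover, if $\phi$ is bounded and there is $L>0$ with $\beta(t)+1/\mu(t)\le L$ for all $t\ge0$, then $c_1$ can be chosen bounded. -/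

import Mathlib

open Set Filter Topology MeasureTheory
open scoped NNReal

noncomputable section

namespace RFDE

/-! ## Comparison functions

Functions on the half-line `[0, ∞)` are represented by functions `ℝ → ℝ`, of which only the values
on `[0, ∞)` are ever used. -/

/-- The class `K⁺`: positive continuous functions on `[0, ∞)`. -/
structure ClassKPlus (β : ℝ → ℝ) : Prop where
  cont : ContinuousOn β (Ici 0)
  pos : ∀ t, 0 ≤ t → 0 < β t

/-- The class `N`: non-decreasing functions on `[0, ∞)` that vanish at `0`
(no continuity is required). -/
structure ClassN (γ : ℝ → ℝ) : Prop where
  mono : MonotoneOn γ (Ici 0)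
  zero : γ 0 = 0

/-- Continuous positive definite functions `[0, ∞) → [0, ∞)`. -/
structure ContPosDef (ρ : ℝ → ℝ) : Prop where
  cont : ContinuousOn ρ (Ici 0)
  zero : ρ 0 = 0
  pos : ∀ s, 0 < s → 0 < ρ s

/-- The class `K`: continuous, strictly increasing, positive definite functions on `[0, ∞)`. -/
structure ClassK (a : ℝ → ℝ) : Prop where
  cont : ContinuousOn a (Ici 0)
  mono : StrictMonoOn a (Ici 0)
  zero : a 0 = 0

/-- The class `K∞`: unbounded functions of class `K`. -/
structure ClassKInf (a : ℝ → ℝ) : Prop extends ClassK a where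
  lim : Tendsto a atTop atTop

/-- The class `KL`. -/
structure ClassKL (σ : ℝ → ℝ → ℝ) : Prop where
  cont : ContinuousOn (fun p : ℝ × ℝ => σ p.1 p.2) (Ici 0 ×ˢ Ici 0)
  classK : ∀ t, 0 ≤ t → ClassK (fun s => σ s t)
  anti : ∀ s, 0 ≤ s → AntitoneOn (σ s) (Ici 0)
  lim : ∀ s, 0 ≤ s → Tendsto (σ s) atTop (𝓝 0)

/-- The inverse `a⁻¹ : [0, ∞) → [0, ∞)` of a function `a` of class `K∞`, which is a bijection
of `[0, ∞)` onto itself. -/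
def invKInf (a : ℝ → ℝ) : ℝ → ℝ := Function.invFunOn a (Ici 0)

/-- Boundedness from above on `[0, ∞)`. -/
def BoundedOnHalfLine (φ : ℝ → ℝ) : Prop := ∃ C, ∀ t, 0 ≤ t → φ t ≤ C

/-! ## Histories -/

/-- `ℝⁿ` with its Euclidean norm. -/
abbrev Vec (n : ℕ) := EuclideanSpace ℝ (Fin n)

/-- The Banach space `C⁰([-r, 0]; ℝⁿ)` with the supremum norm. -/
abbrev Hist (r : ℝ≥0) (n : ℕ) := C(Icc (-(r : ℝ)) 0, Vec n)

variable {r : ℝ≥0} {n l m k k₁ : ℕ}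

theorem neg_le_zero (r : ℝ≥0) : -(r : ℝ) ≤ 0 := neg_nonpos.2 r.2

/-- The value `x(0)` of a history. -/
def Hist.now (x : Hist r n) : Vec n := x ⟨0, neg_le_zero r, le_rfl⟩

/-- The history `x` as a function on all of `ℝ`, continued by constants outside `[-r, 0]`. -/
def Hist.ext (x : Hist r n) : ℝ → Vec n := IccExtend (neg_le_zero r) x

theorem Hist.continuous_ext (x : Hist r n) : Continuous x.ext :=
  x.continuous.Icc_extend'

theorem Hist.ext_zero (x : Hist r n) : x.ext 0 = x.now :=
  IccExtend_of_mem _ _ (show (0 : ℝ) ∈ Icc (-(r : ℝ)) 0 from ⟨neg_le_zero r, le_rfl⟩)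

/-- The operator `E_h(x; v)`: `x(0) + (θ + h) v` for `-h < θ ≤ 0` and `x(θ + h)` for
`-r ≤ θ ≤ -h`. -/
def Hist.extrapolate (h : ℝ) (x : Hist r n) (v : Vec n) : Hist r n where
  toFun θ := if (θ : ℝ) ≤ -h then x.ext (θ + h) else x.now + ((θ : ℝ) + h) • v
  continuous_toFun := by
    refine Continuous.if_le ?_ ?_ continuous_subtype_val continuous_const ?_
    · exact x.continuous_ext.comp (by fun_prop)
    · fun_prop
    · intro θ hθ
      have h0 : (θ : ℝ) + h = 0 := by rw [hθ]; ring
      rw [h0, x.ext_zero, zero_smul, add_zero]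

/-- The history `T_r(t) x = x(t + ·)` on `[-r, 0]` of a trajectory `x`. -/
def history (r : ℝ≥0) (x : C(ℝ, Vec n)) (t : ℝ) : Hist r n where
  toFun θ := x (t + θ)
  continuous_toFun := by fun_prop

/-! ## Functionals -/

/-- The generalized derivative `V⁰(t, x; v)`: the upper limit, as `h → 0⁺` and `y → 0` in
`C⁰([-r, 0]; ℝⁿ)`, of `(V(t + h, E_h(x; v) + h y) - V(t, x)) / h`, as an extended real number. -/
def genDeriv (V : ℝ → Hist r n → ℝ) (t : ℝ) (x : Hist r n) (v : Vec n) : EReal :=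
  limsup (fun p : ℝ × Hist r n =>
      (((V (t + p.1) (x.extrapolate p.1 v + p.1 • p.2) - V t x) / p.1 : ℝ) : EReal))
    (𝓝[>] (0 : ℝ) ×ˢ 𝓝 (0 : Hist r n))

/-- The essential supremum of `|ẋ|` on `[-r, 0]`. -/
def Hist.speed (x : Hist r n) : ENNReal :=
  essSup (fun τ => ‖deriv x.ext τ‖ₑ) (volume.restrict (Icc (-(r : ℝ)) 0))

/-- Continuous functionals `V : [0, ∞) × C⁰([-r, 0]; ℝⁿ) → [0, ∞)` that are almost Lipschitz on
bounded sets. -/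
structure AlmostLipschitz (V : ℝ → Hist r n → ℝ) : Prop where
  nonneg : ∀ t, 0 ≤ t → ∀ x, 0 ≤ V t x
  cont : ContinuousOn (fun p : ℝ × Hist r n => V p.1 p.2) (Ici 0 ×ˢ univ)
  almostLip : ∃ M P G : ℝ → ℝ,
    MonotoneOn M (Ici 0) ∧ (∀ R, 0 ≤ R → 0 ≤ M R) ∧
    MonotoneOn P (Ici 0) ∧ (∀ R, 0 ≤ R → 0 ≤ P R) ∧
    MonotoneOn G (Ici 0) ∧ (∀ R, 0 ≤ R → 1 ≤ G R) ∧
    ∀ R, 0 ≤ R →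
      (∀ x y : Hist r n, ‖x‖ ≤ R → ‖y‖ ≤ R → ∀ t ∈ Icc 0 R,
        |V t y - V t x| ≤ M R * ‖y - x‖) ∧
      (∀ x : Hist r n, ‖x‖ ≤ R → AbsolutelyContinuousOnInterval x.ext (-(r : ℝ)) 0 →
        x.speed ≠ ⊤ → ∀ t ∈ Icc 0 R, ∀ h, 0 ≤ h → h ≤ 1 / G (R + x.speed.toReal) →
        |V (t + h) x - V t x| ≤ h * P R * (1 + x.speed.toReal))

/-! ## The control system -/

/-- `L^∞_loc([0, ∞); S)`: Lebesgue measurable, locally bounded inputs with values in `S`. -/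
structure IsInput (S : Set (Vec k)) (w : ℝ → Vec k) : Prop where
  meas : AEMeasurable w (volume.restrict (Ici 0))
  mem : ∀ t, 0 ≤ t → w t ∈ S
  bdd : ∀ T, ∃ C, ∀ t ∈ Icc 0 T, ‖w t‖ ≤ C

/-- Standing hypotheses on the right-hand side `f(t, d, x, u, v)` and the output map `H(t, x)` of
the control system `ẋ(t) = f(t, d(t), T_r(t)x, u(t), v(t))`, `Y(t) = H(t, T_r(t)x)`, with
`d ∈ D`, `u ∈ U`, `v ∈ S₂`, `Y ∈ S₁`. -/
structure SystemHyp (D : Set (Vec l)) (U : Set (Vec m)) (S₁ : Set (Vec k₁)) (S₂ : Set (Vec k))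
    (f : ℝ → Vec l → Hist r n → Vec m → Vec k → Vec n) (H : ℝ → Hist r n → Vec k₁) : Prop where
  D_nonempty : D.Nonempty
  zero_mem_U : (0 : Vec m) ∈ U
  zero_mem_S₁ : (0 : Vec k₁) ∈ S₁
  zero_mem_S₂ : (0 : Vec k) ∈ S₂
  -- the output map
  H_mem : ∀ t, 0 ≤ t → ∀ x, H t x ∈ S₁
  H_cont : ContinuousOn (fun p : ℝ × Hist r n => H p.1 p.2) (Ici 0 ×ˢ univ)
  H_bdd : ∀ Ω : Set (ℝ × Hist r n), Ω ⊆ Ici 0 ×ˢ univ → Bornology.IsBounded Ω →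
    Bornology.IsBounded ((fun p : ℝ × Hist r n => H p.1 p.2) '' Ω)
  H_zero : ∀ t, 0 ≤ t → H t 0 = 0
  -- growth of the right-hand side
  f_growth : ∃ β a : ℝ → ℝ, ClassKPlus β ∧ ClassKInf a ∧
    ∀ t, 0 ≤ t → ∀ d ∈ D, ∀ x : Hist r n, ∀ u ∈ U, ∀ v ∈ S₂,
      ‖f t d x u v‖ ≤ a (β t * ‖x‖) + a (β t * ‖u‖) + a (β t * ‖v‖)
  -- continuity for fixed time, and the one-sided Lipschitz condition
  f_cont : ∀ t, 0 ≤ t →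
    ContinuousOn (fun q : Hist r n × Vec m × Vec k × Vec l => f t q.2.2.2 q.1 q.2.1 q.2.2.1)
      (univ ×ˢ U ×ˢ S₂ ×ˢ D)
  f_oneSidedLip : ∀ I : Set ℝ, I ⊆ Ici 0 → Bornology.IsBounded I →
    ∀ Ω : Set (Hist r n × Vec m × Vec k), Ω ⊆ univ ×ˢ U ×ˢ S₂ → Bornology.IsBounded Ω →
      ∃ L : ℝ, 0 ≤ L ∧ ∀ t ∈ I, ∀ (x y : Hist r n) (u : Vec m) (v : Vec k),
        (x, u, v) ∈ Ω → (y, u, v) ∈ Ω → ∀ d ∈ D,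
          inner ℝ (x.now - y.now) (f t d x u v - f t d y u v) ≤ L * ‖x - y‖ ^ 2
  -- joint continuity away from a discrete set of times, and continuity from the right in time
  f_time : ∃ A : Set ℝ, A ⊆ Ici 0 ∧
    (A.Finite ∨ ∃ s : ℕ → ℝ, StrictMono s ∧ (∀ j, 0 < s j) ∧ Tendsto s atTop atTop ∧
      A = range s) ∧
    ContinuousOn (fun p : ℝ × Hist r n × Vec m × Vec k × Vec l =>
        f p.1 p.2.2.2.2 p.2.1 p.2.2.1 p.2.2.2.1)
      ((Ici 0 \ A) ×ˢ univ ×ˢ U ×ˢ S₂ ×ˢ D)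
  f_right : ∀ t₀, 0 ≤ t₀ → ∀ d ∈ D, ∀ x : Hist r n, ∀ u ∈ U, ∀ v ∈ S₂,
    Tendsto (fun t => f t d x u v) (𝓝[>] t₀) (𝓝 (f t₀ d x u v))

/-- `x` is a solution on `[t₀, ∞)` of `ẋ(t) = f(t, d(t), T_r(t)x, u(t), v(t))` with
`T_r(t₀)x = x₀`. Trajectories are defined on `[t₀ - r, ∞)`; here they are continued to all of `ℝ`
in an arbitrary continuous way, and only their values on `[t₀ - r, ∞)` are used. -/
structure IsSolution (f : ℝ → Vec l → Hist r n → Vec m → Vec k → Vec n) (t₀ : ℝ) (x₀ : Hist r n)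
    (v : ℝ → Vec k) (u : ℝ → Vec m) (d : ℝ → Vec l) (x : C(ℝ, Vec n)) : Prop where
  init : history r x t₀ = x₀
  absCont : ∀ T, t₀ ≤ T → AbsolutelyContinuousOnInterval x t₀ T
  ode : ∀ᵐ t, t₀ ≤ t → HasDerivAt x (f t (d t) (history r x t) (u t) (v t)) t

/-- For all initial times, initial histories and inputs, the solution exists for all `t ≥ t₀`. -/
def ForwardComplete (D : Set (Vec l)) (U : Set (Vec m)) (S₂ : Set (Vec k))
    (f : ℝ → Vec l → Hist r n → Vec m → Vec k → Vec n) : Prop :=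
  ∀ t₀, 0 ≤ t₀ → ∀ (x₀ : Hist r n) (v : ℝ → Vec k) (u : ℝ → Vec m) (d : ℝ → Vec l),
    IsInput S₂ v → IsInput U u → IsInput D d → ∃ x, IsSolution f t₀ x₀ v u d x

/-- The growth estimate
`φ(t) ‖T_r(t)x‖ ≤ max {μ₁(t - t₀), c₁(t₀), g₁(‖x₀‖), sup p₁(|v|), sup p₁ᵘ(δᵘ |u|)}`. -/
def GrowthEstimate (D : Set (Vec l)) (U : Set (Vec m)) (S₂ : Set (Vec k))
    (f : ℝ → Vec l → Hist r n → Vec m → Vec k → Vec n)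
    (φ δᵤ μ₁ c₁ g₁ p₁ p₁ᵤ : ℝ → ℝ) : Prop :=
  ∀ t₀, 0 ≤ t₀ → ∀ (x₀ : Hist r n) (v : ℝ → Vec k) (u : ℝ → Vec m) (d : ℝ → Vec l),
    IsInput S₂ v → IsInput U u → IsInput D d → ∀ x, IsSolution f t₀ x₀ v u d x →
      ∀ t, t₀ ≤ t →
        φ t * ‖history r x t‖ ≤
          max (μ₁ (t - t₀)) (max (c₁ t₀) (max (g₁ ‖x₀‖)
            (max (⨆ τ : Icc t₀ t, p₁ ‖v τ‖) (⨆ τ : Icc t₀ t, p₁ᵤ (δᵤ τ * ‖u τ‖)))))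

/-- The output estimate
`|H(t, T_r(t)x)| ≤ σ(β(t₀) ‖x₀‖, t - t₀) + sup γ(δ |v|) + sup γᵘ(δᵘ |u|)`. -/
def OutputEstimate (D : Set (Vec l)) (U : Set (Vec m)) (S₂ : Set (Vec k))
    (f : ℝ → Vec l → Hist r n → Vec m → Vec k → Vec n) (H : ℝ → Hist r n → Vec k₁)
    (σ : ℝ → ℝ → ℝ) (β γ δ γᵤ δᵤ : ℝ → ℝ) : Prop :=
  ∀ t₀, 0 ≤ t₀ → ∀ (x₀ : Hist r n) (v : ℝ → Vec k) (u : ℝ → Vec m) (d : ℝ → Vec l),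
    IsInput S₂ v → IsInput U u → IsInput D d → ∀ x, IsSolution f t₀ x₀ v u d x →
      ∀ t, t₀ ≤ t →
        ‖H t (history r x t)‖ ≤
          σ (β t₀ * ‖x₀‖) (t - t₀) + (⨆ τ : Icc t₀ t, γ (δ τ * ‖v τ‖)) +
            ⨆ τ : Icc t₀ t, γᵤ (δᵤ τ * ‖u τ‖)

end RFDE

end

/-! Along a solution put W(t) = V(t, T_r(t)x). If W is Lipschitz, then it is differentiable almost
everywhere, its derivative is at most V⁰ (`le_genDeriv`), and hence W' ≤ -ρ(W) wherever W is at
least the supremum S of the input gains over the interval. Comparison with the flow of ẇ =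
-min(ρ(w), w), which is of class KL, gives W(T) ≤ max(flow of W(t₀) for time T - t₀, S); this is
`le_max_decayFlow`.

W need not be Lipschitz when the initial history is merely continuous. Lipschitz histories are
dense, and solutions starting from them have Lipschitz histories on compact time intervals.
One-sided Lipschitz continuity of f gives continuous dependence on the initial history, so the
estimate passes to the limit (`Dissipative.le`). This requires an existence theory: after cutting f
off outside a ball of histories, `BoundedField.exists_solution` solves the equation with a small
delay in the right-hand side, and `BoundedField.compare` shows that these approximations are
uniformly Cauchy.

The output estimate follows by applying a₁⁻¹ to the estimate for W. For completeness, the lower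
bound on V turns the same estimate into an a priori bound on |x(t)|, so that a solution of a
suitably truncated equation never meets the truncation; solutions on compact intervals are then
glued by uniqueness. For the growth estimate, φ(t)|x(s)| is a product of a weight in t and a bound
from p⁻¹; each factor is at most √C, where C is the maximum on the right of (G), and this is why the
functions in (G) are built from squares. -/

namespace RFDE

/-! ### Comparison functions -/

namespace ClassK

variable {a : ℝ → ℝ}

theorem nonneg (ha : ClassK a) {x : ℝ} (hx : 0 ≤ x) : 0 ≤ a x := by
  simpa [ha.zero] using ha.mono.monotoneOn self_mem_Ici hx hx

theorem le_iff (ha : ClassK a) {x y : ℝ} (hx : 0 ≤ x) (hy : 0 ≤ y) : a x ≤ a y ↔ x ≤ y :=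
  ha.mono.le_iff_le hx hy

end ClassK

theorem ClassN.nonneg {γ : ℝ → ℝ} (h : ClassN γ) {x : ℝ} (hx : 0 ≤ x) : 0 ≤ γ x := by
  simpa [h.zero] using h.mono self_mem_Ici hx hx

namespace ClassKInf

variable {a : ℝ → ℝ}

theorem surjOn (ha : ClassKInf a) : SurjOn a (Ici 0) (Ici 0) := by
  intro y hy
  obtain ⟨b, hb, hb0⟩ := ((ha.lim.eventually_ge_atTop y).and (eventually_ge_atTop 0)).exists
  have := intermediate_value_Icc hb0 (ha.cont.mono Icc_subset_Ici_self)
  obtain ⟨x, hx, rfl⟩ := this ⟨by rw [ha.zero]; exact hy, hb⟩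
  exact ⟨x, hx.1, rfl⟩

theorem inv_nonneg (ha : ClassKInf a) {y : ℝ} (hy : 0 ≤ y) : 0 ≤ invKInf a y :=
  ha.surjOn.mapsTo_invFunOn hy

theorem apply_inv (ha : ClassKInf a) {y : ℝ} (hy : 0 ≤ y) : a (invKInf a y) = y :=
  ha.surjOn.rightInvOn_invFunOn hy

theorem inv_apply (ha : ClassKInf a) {x : ℝ} (hx : 0 ≤ x) : invKInf a (a x) = x :=
  ha.mono.injOn.leftInvOn_invFunOn hx

theorem inv_le_iff (ha : ClassKInf a) {x y : ℝ} (hx : 0 ≤ x) (hy : 0 ≤ y) :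
    invKInf a y ≤ x ↔ y ≤ a x := by
  rw [← ha.le_iff (ha.inv_nonneg hy) hx, ha.apply_inv hy]

theorem le_inv_iff (ha : ClassKInf a) {x y : ℝ} (hx : 0 ≤ x) (hy : 0 ≤ y) :
    x ≤ invKInf a y ↔ a x ≤ y := by
  rw [← ha.le_iff hx (ha.inv_nonneg hy), ha.apply_inv hy]

theorem inv_strictMonoOn (ha : ClassKInf a) : StrictMonoOn (invKInf a) (Ici 0) := by
  intro x hx y hy hxy
  rw [← not_le, ha.le_inv_iff (ha.inv_nonneg hy) hx, ha.apply_inv hy]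
  exact not_le.2 hxy

/-- Continued by the identity to negative arguments, the inverse becomes a monotone surjection of
the line, and such a map is continuous. -/
theorem inv_continuousOn (ha : ClassKInf a) : ContinuousOn (invKInf a) (Ici 0) := by
  let j : ℝ → ℝ := fun y => if 0 ≤ y then invKInf a y else y
  have hmono : Monotone j := by
    intro x y hxy
    by_cases hx : 0 ≤ x
    · simpa [j, hx, hx.trans hxy] using ha.inv_strictMonoOn.monotoneOn hx (hx.trans hxy) hxy
    · by_cases hy : 0 ≤ y
      · simpa [j, hx, hy] using (not_le.1 hx).le.trans (ha.inv_nonneg hy)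
      · simpa [j, hx, hy] using hxy
  have hsurj : Function.Surjective j := by
    intro x
    by_cases hx : 0 ≤ x
    · exact ⟨a x, by simp [j, ha.nonneg hx, ha.inv_apply hx]⟩
    · exact ⟨x, by simp [j, hx]⟩
  refine (hmono.continuous_of_surjective hsurj).continuousOn.congr fun y hy => ?_
  simp [j, mem_Ici.1 hy]

theorem inv_zero (ha : ClassKInf a) : invKInf a 0 = 0 := by
  simpa [ha.zero] using ha.inv_apply le_rfl

theorem classK_inv (ha : ClassKInf a) : ClassK (invKInf a) :=
  ⟨ha.inv_continuousOn, ha.inv_strictMonoOn, ha.inv_zero⟩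

end ClassKInf

/-- The inverse of a function of class `K∞` commutes with suprema. -/
theorem ClassKInf.inv_iSup_le {a : ℝ → ℝ} (ha : ClassKInf a) {ι : Type*} [Nonempty ι] {g : ι → ℝ}
    (h0 : ∀ i, 0 ≤ g i) (hb : BddAbove (range g)) :
    invKInf a (⨆ i, g i) ≤ ⨆ i, invKInf a (g i) := by
  have hS : 0 ≤ ⨆ i, g i := Real.iSup_nonneg h0
  have hb' : BddAbove (range fun i => invKInf a (g i)) := by
    refine ⟨invKInf a (⨆ i, g i), ?_⟩
    rintro _ ⟨i, rfl⟩
    exact ha.inv_strictMonoOn.monotoneOn (h0 i) hS (le_ciSup hb i)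
  have hI : 0 ≤ ⨆ i, invKInf a (g i) := Real.iSup_nonneg fun i => ha.inv_nonneg (h0 i)
  rw [ha.inv_le_iff hI hS]
  exact ciSup_le fun i => (ha.inv_le_iff hI (h0 i)).1 (le_ciSup hb' i)

/-- A continuous function on `[0, ∞)` has a continuous non-decreasing majorant. -/
theorem exists_monotone_majorant {φ : ℝ → ℝ} (hφ : ContinuousOn φ (Ici 0)) :
    ∃ Φ : ℝ → ℝ, Continuous Φ ∧ MonotoneOn Φ (Ici 0) ∧ ∀ t, 0 ≤ t → φ t ≤ Φ t := by
  let g : ℝ → ℝ := fun t => φ (max t 0)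
  have hg : Continuous g :=
    hφ.comp_continuous (by fun_prop) fun t => le_max_right t 0
  -- The majorant is the running maximum over [0, t]. Writing the points as c * t with c in the
  -- fixed compact interval [0, 1] makes it a supremum over a parameter-independent set, hence
  -- continuous in t.
  let F : ℝ → ℝ → ℝ := fun t c => g (c * t)
  have hF : Continuous ↿F := hg.comp (by fun_prop)
  have hbdd : ∀ t, BddAbove (F t '' Icc 0 1) := fun t =>
    (isCompact_Icc.image (hF.comp (by fun_prop : Continuous fun c : ℝ => (t, c)))).bddAbove
  refine ⟨fun t => sSup (F t '' Icc 0 1), isCompact_Icc.continuous_sSup hF, ?_, ?_⟩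
  · intro s hs t ht hst
    refine csSup_le (nonempty_Icc.2 zero_le_one |>.image _) ?_
    rintro _ ⟨c, hc, rfl⟩
    rcases (mem_Ici.1 ht).eq_or_lt with h | h
    · have : s = t := le_antisymm hst (h ▸ hs)
      exact le_csSup (hbdd t) ⟨c, hc, by rw [this]⟩
    · refine le_csSup (hbdd t) ⟨c * s / t, ⟨?_, ?_⟩, ?_⟩
      · exact div_nonneg (mul_nonneg hc.1 hs) h.le
      · rw [div_le_one h]
        nlinarith [hc.1, hc.2, mem_Ici.1 hs]
      · simp only [F]
        rw [div_mul_cancel₀ _ h.ne']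
  · intro t ht
    exact le_csSup (hbdd t) ⟨1, ⟨zero_le_one, le_rfl⟩, by simp [F, g, ht]⟩

/-- A continuous function on `[0, ∞)` is bounded on compact intervals. -/
theorem exists_bound_Icc {φ : ℝ → ℝ} (hφ : ContinuousOn φ (Ici 0)) (T : ℝ) :
    ∃ C, 0 ≤ C ∧ ∀ t ∈ Icc 0 T, φ t ≤ C := by
  obtain ⟨C, hC⟩ := isCompact_Icc.bddAbove_image (hφ.mono (Icc_subset_Ici_self : Icc 0 T ⊆ Ici 0))
  exact ⟨max C 0, le_max_right _ _, fun t ht => (hC ⟨t, ht, rfl⟩).trans (le_max_left _ _)⟩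

end RFDE

/-! ### Scalar comparison for dissipation inequalities -/

namespace RFDE

/-! ### Absolutely continuous functions and differential inequalities -/

theorem sub_le_integral_of_deriv_le {f h : ℝ → ℝ} {a b : ℝ} (hab : a ≤ b)
    (hf : AbsolutelyContinuousOnInterval f a b) (hh : IntervalIntegrable h volume a b)
    (hle : ∀ᵐ t, t ∈ Icc a b → deriv f t ≤ h t) : f b - f a ≤ ∫ t in a..b, h t := by
  rw [← hf.integral_deriv_eq_sub]
  refine intervalIntegral.integral_mono_ae_restrict hab hf.intervalIntegrable_deriv hh ?_
  exact (ae_restrict_iff' measurableSet_Icc).2 hle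

theorem ae_hasDerivAt_of_lipschitzOn {W : ℝ → ℝ} {C : ℝ≥0} {a b : ℝ} (hab : a ≤ b)
    (hW : LipschitzOnWith C W (Icc a b)) : ∀ᵐ t, t ∈ Icc a b → HasDerivAt W (deriv W t) t := by
  have hac : AbsolutelyContinuousOnInterval W a b :=
    LipschitzOnWith.absolutelyContinuousOnInterval (by rwa [uIcc_of_le hab])
  filter_upwards [hac.ae_differentiableAt] with t ht hm
  exact (ht (by rwa [uIcc_of_le hab])).hasDerivAt

theorem lipschitzOn_absCont {X : Type*} [PseudoMetricSpace X] {W : ℝ → X} {C : ℝ≥0} {a b : ℝ}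
    (hab : a ≤ b)
    (hW : LipschitzOnWith C W (Icc a b)) : AbsolutelyContinuousOnInterval W a b :=
  LipschitzOnWith.absolutelyContinuousOnInterval (by rwa [uIcc_of_le hab])

/-! ### The function of class `KL` generated by `ẇ ≤ -ρ(w)` -/

/-- `w / min (ρ w) w` at `w = exp y`. -/
noncomputable def decayRate (ρ : ℝ → ℝ) (y : ℝ) : ℝ := max (Real.exp y / ρ (Real.exp y)) 1

variable {ρ : ℝ → ℝ}

theorem continuous_decayRate (hρ : ContPosDef ρ) : Continuous (decayRate ρ) := by
  have : Continuous fun y => ρ (Real.exp y) :=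
    hρ.cont.comp_continuous Real.continuous_exp fun y => (Real.exp_pos y).le
  exact (Real.continuous_exp.div this fun y => (hρ.pos _ (Real.exp_pos y)).ne').max
    continuous_const

/-- The time that `ẇ = -min (ρ w) w` takes to descend, as a function of `log w`. -/
noncomputable def decayTime (ρ : ℝ → ℝ) (z : ℝ) : ℝ := ∫ y in (0 : ℝ)..z, decayRate ρ y

theorem hasDerivAt_decayTime (hρ : ContPosDef ρ) (z : ℝ) :
    HasDerivAt (decayTime ρ) (decayRate ρ z) z :=
  intervalIntegral.integral_hasDerivAt_right
    ((continuous_decayRate hρ).intervalIntegrable _ _)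
    (continuous_decayRate hρ).aestronglyMeasurable.stronglyMeasurableAtFilter
    (continuous_decayRate hρ).continuousAt

/-- The rate is at least 1, which is the purpose of replacing ρ(w) by min(ρ(w), w). Thus `decayTime`
is expanding and maps onto the whole line: the flow exists for all times and never reaches 0 from a
positive value. -/
theorem sub_le_decayTime_sub (hρ : ContPosDef ρ) {y z : ℝ} (h : y ≤ z) :
    z - y ≤ decayTime ρ z - decayTime ρ y := by
  have hmono : Monotone fun z => decayTime ρ z - z := by
    refine monotone_of_hasDerivAt_nonneg (f' := fun z => decayRate ρ z - 1)
      (fun z => (hasDerivAt_decayTime hρ z).sub (hasDerivAt_id z)) fun z => ?_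
    simp [decayRate]
  have := hmono h
  simp only at this
  linarith

theorem strictMono_decayTime (hρ : ContPosDef ρ) : StrictMono (decayTime ρ) := fun y z h => by
  linarith [sub_le_decayTime_sub hρ h.le]

theorem continuous_decayTime (hρ : ContPosDef ρ) : Continuous (decayTime ρ) :=
  continuous_iff_continuousAt.2 fun z => (hasDerivAt_decayTime hρ z).continuousAt

theorem surjective_decayTime (hρ : ContPosDef ρ) : Function.Surjective (decayTime ρ) := by
  have h0 : decayTime ρ 0 = 0 := by simp [decayTime]
  refine (continuous_decayTime hρ).surjective ?_ ?_
  · refine tendsto_atTop_mono' _ ?_ tendsto_id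
    filter_upwards [eventually_ge_atTop 0] with z hz
    simpa [h0] using sub_le_decayTime_sub hρ hz
  · refine tendsto_atBot_mono' _ ?_ tendsto_id
    filter_upwards [eventually_le_atBot 0] with z hz
    simpa [h0] using sub_le_decayTime_sub hρ hz

/-- `decayTime` as an order isomorphism. -/
noncomputable def decayIso (hρ : ContPosDef ρ) : ℝ ≃o ℝ :=
  StrictMono.orderIsoOfSurjective _ (strictMono_decayTime hρ) (surjective_decayTime hρ)

theorem decayIso_apply (hρ : ContPosDef ρ) (z : ℝ) : decayIso hρ z = decayTime ρ z := rfl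

/-- The flow of `ẇ = -min (ρ w) w`. -/
noncomputable def decayFlow (hρ : ContPosDef ρ) (s t : ℝ) : ℝ :=
  if s ≤ 0 then 0 else Real.exp ((decayIso hρ).symm (decayIso hρ (Real.log s) - t))

theorem decayFlow_of_pos (hρ : ContPosDef ρ) {s : ℝ} (hs : 0 < s) (t : ℝ) :
    decayFlow hρ s t = Real.exp ((decayIso hρ).symm (decayIso hρ (Real.log s) - t)) := by
  simp [decayFlow, not_le.2 hs]

theorem decayFlow_nonneg (hρ : ContPosDef ρ) (s t : ℝ) : 0 ≤ decayFlow hρ s t := by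
  unfold decayFlow
  split_ifs
  · exact le_rfl
  · positivity

theorem decayFlow_le (hρ : ContPosDef ρ) {s t : ℝ} (hs : 0 ≤ s) (ht : 0 ≤ t) :
    decayFlow hρ s t ≤ s := by
  rcases hs.eq_or_lt with rfl | h
  · simp [decayFlow]
  · rw [decayFlow_of_pos hρ h, ← Real.le_log_iff_exp_le h, OrderIso.symm_apply_le]
    linarith

/-- For s > 0 the flow is a translation conjugated by homeomorphisms. The logarithm is singular at s
= 0, where continuity comes instead from 0 ≤ flow ≤ s. -/
theorem classKL_decayFlow (hρ : ContPosDef ρ) : ClassKL (decayFlow hρ) := by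
  have hcont : ContinuousOn (fun p : ℝ × ℝ => decayFlow hρ p.1 p.2) (Ici 0 ×ˢ Ici 0) := by
    rintro ⟨s, t⟩ ⟨hs, ht⟩
    rcases (mem_Ici.1 hs).eq_or_lt with h | h
    · simp only at h
      subst h
      have h0 : decayFlow hρ 0 t = 0 := by simp [decayFlow]
      rw [ContinuousWithinAt, h0]
      refine squeeze_zero' (.of_forall fun p => decayFlow_nonneg hρ _ _)
        (g := fun p : ℝ × ℝ => p.1) ?_ ?_
      · filter_upwards [self_mem_nhdsWithin] with p hp using decayFlow_le hρ hp.1 hp.2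
      · exact (continuous_fst.tendsto ((0 : ℝ), t)).mono_left nhdsWithin_le_nhds
    · refine ContinuousAt.continuousWithinAt ?_
      have : (fun p : ℝ × ℝ => Real.exp ((decayIso hρ).symm (decayIso hρ (Real.log p.1) - p.2)))
          =ᶠ[𝓝 (s, t)] fun p : ℝ × ℝ => decayFlow hρ p.1 p.2 := by
        filter_upwards [continuous_fst.continuousAt.eventually_mem (Ioi_mem_nhds h)] with p hp
        exact (decayFlow_of_pos hρ hp _).symm
      refine ContinuousAt.congr ?_ this
      refine Real.continuous_exp.continuousAt.comp ?_
      refine (decayIso hρ).symm.continuous.continuousAt.comp ?_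
      refine ContinuousAt.sub ?_ continuous_snd.continuousAt
      refine (decayIso hρ).continuous.continuousAt.comp ?_
      exact continuous_fst.continuousAt.log h.ne'
  refine ⟨hcont, fun t ht => ⟨?_, ?_, by simp [decayFlow]⟩, ?_, ?_⟩
  · exact hcont.comp (f := fun s => (s, t)) (by fun_prop) fun s hs => ⟨hs, ht⟩
  · intro s hs s' hs' hss
    have hs'0 : 0 < s' := lt_of_le_of_lt hs hss
    rcases (mem_Ici.1 hs).eq_or_lt with h | h
    · subst h
      simp only [decayFlow_of_pos hρ hss]
      simp [decayFlow, Real.exp_pos]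
    · simp only [decayFlow_of_pos hρ hs'0, decayFlow_of_pos hρ h]
      rw [Real.exp_lt_exp, OrderIso.lt_iff_lt, sub_lt_sub_iff_right, OrderIso.lt_iff_lt]
      exact Real.log_lt_log h hss
  · intro s hs t ht t' ht' htt
    rcases hs.eq_or_lt with h | h
    · simp [← h, decayFlow]
    · rw [decayFlow_of_pos hρ h, decayFlow_of_pos hρ h, Real.exp_le_exp, OrderIso.le_iff_le]
      linarith
  · intro s hs
    rcases hs.eq_or_lt with h | h
    · subst h
      have : decayFlow hρ 0 = fun _ => 0 := by ext; simp [decayFlow]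
      rw [this]
      exact tendsto_const_nhds
    · have : decayFlow hρ s = fun t => Real.exp ((decayIso hρ).symm (decayIso hρ (Real.log s) - t)) := by
        ext t; exact decayFlow_of_pos hρ h t
      rw [this]
      refine Real.tendsto_exp_atBot.comp ((decayIso hρ).symm.tendsto_atBot.comp ?_)
      exact tendsto_atBot_add_const_left _ _ tendsto_neg_atTop_atBot

/-- A Lipschitz function that decays according to `ẇ ≤ -ρ(w)` as long as it is at least `S`. -/
theorem le_max_decayFlow (hρ : ContPosDef ρ) {W : ℝ → ℝ} {C : ℝ≥0} {a b S : ℝ} (hab : a ≤ b)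
    (hS : 0 ≤ S) (hW : LipschitzOnWith C W (Icc a b))
    (hd : ∀ᵐ t, t ∈ Icc a b → S ≤ W t → deriv W t ≤ -ρ (W t)) :
    W b ≤ max (decayFlow hρ (W a) (b - a)) S := by
  by_contra! hcon
  obtain ⟨h1, h2⟩ := max_lt_iff.1 hcon
  have hρ0 : ∀ s, 0 ≤ s → 0 ≤ ρ s := fun s hs => by
    rcases hs.eq_or_lt with h | h
    · rw [← h, hρ.zero]
    · exact (hρ.pos s h).le
  -- If W were below its final value at some t₁, take the last time c in [t₁, b] with W ≤ max S (W
  -- t₁). After c the function exceeds S, so it cannot increase, and it cannot climb to W b. Hence W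
  -- > S throughout and the decay is in force on all of [a, b].
  have hge : ∀ t ∈ Icc a b, W b ≤ W t := by
    intro t₁ ht₁
    by_contra! hlt
    set m := max S (W t₁) with hm
    have hmb : m < W b := max_lt h2 hlt
    have hcont : ContinuousOn W (Icc t₁ b) := hW.continuousOn.mono (Icc_subset_Icc_left ht₁.1)
    let A := Icc t₁ b ∩ W ⁻¹' Iic m
    have hA : IsCompact A :=
      isCompact_Icc.of_isClosed_subset (hcont.preimage_isClosed_of_isClosed isClosed_Icc
        isClosed_Iic) inter_subset_left
    have hAne : A.Nonempty := by
      refine ⟨t₁, ⟨le_rfl, ht₁.2⟩, ?_⟩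
      rw [mem_preimage, mem_Iic]
      exact le_max_right _ _
    have hc := hA.sSup_mem hAne
    set c := sSup A
    have hcb : c ≤ b := hc.1.2
    have hsub : Icc c b ⊆ Icc a b := Icc_subset_Icc_left (ht₁.1.trans hc.1.1)
    have key := sub_le_integral_of_deriv_le (h := fun _ => 0) hcb
      (lipschitzOn_absCont hcb (hW.mono hsub)) (by simp) (by
        have hne : ∀ᵐ t : ℝ, t ≠ c := by simp [ae_iff]
        filter_upwards [hd, hne] with t ht htc htm
        have hWt : m < W t := by
          by_contra! hle
          have : t ≤ c := le_csSup hA.bddAbove ⟨⟨hc.1.1.trans htm.1, htm.2⟩, hle⟩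
          exact htc (le_antisymm this htm.1)
        have hSt : S ≤ W t := (le_max_left _ _).trans hWt.le
        have := ht (hsub htm) hSt
        linarith [hρ0 (W t) (hS.trans hSt)])
    have hcm : W c ≤ m := hc.2
    simp at key
    linarith
  have hb0 : 0 < W b := hS.trans_lt h2
  have hpos : ∀ t ∈ Icc a b, 0 < W t := fun t ht => hb0.trans_le (hge t ht)
  obtain ⟨B, hB⟩ := isCompact_Icc.bddAbove_image hW.continuousOn
  -- In the time coordinate ψ the decay has speed at least 1: (ψ ∘ W)' ≤ -1. The values of W lie in
  -- the compact interval [W b, B] away from 0, so ψ is Lipschitz there and ψ ∘ W is absolutely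
  -- continuous.
  let ψ : ℝ → ℝ := fun s => decayTime ρ (Real.log s)
  let ψ' : ℝ → ℝ := fun s => decayRate ρ (Real.log s) * s⁻¹
  have hψ : ∀ s, 0 < s → HasDerivAt ψ (ψ' s) s := fun s hs =>
    (hasDerivAt_decayTime hρ _).comp s (Real.hasDerivAt_log hs.ne')
  have hψ'c : ContinuousOn ψ' (Icc (W b) B) := by
    intro s hs
    have hs0 : s ≠ 0 := (hb0.trans_le hs.1).ne'
    exact (((continuous_decayRate hρ).continuousAt.comp (Real.continuousAt_log hs0)).mul
      (continuousAt_inv₀ hs0)).continuousWithinAt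
  obtain ⟨K, hK⟩ := isCompact_Icc.exists_bound_of_continuousOn hψ'c
  have hψlip : LipschitzOnWith K.toNNReal ψ (Icc (W b) B) := by
    refine (convex_Icc _ _).lipschitzOnWith_of_nnnorm_hasDerivWithin_le
      (fun s hs => (hψ s (hb0.trans_le hs.1)).hasDerivWithinAt) fun s hs => ?_
    rw [← NNReal.coe_le_coe, coe_nnnorm]
    exact (hK s hs).trans (Real.le_coe_toNNReal K)
  have hcomp : LipschitzOnWith (K.toNNReal * C) (ψ ∘ W) (Icc a b) :=
    hψlip.comp hW fun t ht => ⟨hge t ht, hB ⟨t, ht, rfl⟩⟩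
  have key := sub_le_integral_of_deriv_le (h := fun _ => -1) hab (lipschitzOn_absCont hab hcomp)
    (by simp) (by
      filter_upwards [hd, ae_hasDerivAt_of_lipschitzOn hab hW] with t ht htd htm
      have hWt := hpos t htm
      have hρt := hρ.pos _ hWt
      have hle := ht htm (h2.le.trans (hge t htm))
      rw [((hψ _ hWt).comp t (htd htm)).deriv]
      have hr : W t / ρ (W t) ≤ decayRate ρ (Real.log (W t)) := by
        simp only [decayRate, Real.exp_log hWt]
        exact le_max_left _ _
      have hψ1 : (ρ (W t))⁻¹ ≤ ψ' (W t) := by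
        calc (ρ (W t))⁻¹ = W t / ρ (W t) * (W t)⁻¹ := by field_simp
          _ ≤ _ := mul_le_mul_of_nonneg_right hr (inv_nonneg.2 hWt.le)
      have hψ0 : 0 < ψ' (W t) := (inv_pos.2 hρt).trans_le hψ1
      calc ψ' (W t) * deriv W t ≤ ψ' (W t) * (-ρ (W t)) := by gcongr
        _ = -(ψ' (W t) * ρ (W t)) := by ring
        _ ≤ -((ρ (W t))⁻¹ * ρ (W t)) := by gcongr
        _ = -1 := by rw [inv_mul_cancel₀ hρt.ne'])
  have ha0 := hpos a ⟨le_rfl, hab⟩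
  rw [decayFlow_of_pos hρ ha0, ← Real.lt_log_iff_exp_lt hb0] at h1
  rw [OrderIso.symm_apply_lt] at h1
  simp [ψ, ← decayIso_apply hρ] at key
  linarith

end RFDE

/-! ### Comparison of approximate solutions of retarded equations -/

namespace RFDE

variable {r : ℝ≥0} {n : ℕ}

/-! ### Histories -/

theorem Hist.norm_now_le (x : Hist r n) : ‖x.now‖ ≤ ‖x‖ := x.norm_coe_le_norm _

theorem Hist.now_sub (x y : Hist r n) : (x - y).now = x.now - y.now := rfl

theorem Hist.ext_of_nonneg (x : Hist r n) {t : ℝ} (ht : 0 ≤ t) : x.ext t = x.now :=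
  IccExtend_of_right_le _ _ ht

theorem Hist.ext_apply (x : Hist r n) (θ : Icc (-(r : ℝ)) 0) : x.ext θ = x θ :=
  IccExtend_val _ _ _

theorem Hist.norm_ext_le (x : Hist r n) (t : ℝ) : ‖x.ext t‖ ≤ ‖x‖ := x.norm_coe_le_norm _

theorem Hist.uniformContinuous_ext (x : Hist r n) : UniformContinuous x.ext :=
  (CompactSpace.uniformContinuous_of_continuous x.continuous).comp
    (LipschitzWith.projIcc (neg_le_zero r)).uniformContinuous

theorem history_apply (x : C(ℝ, Vec n)) (t : ℝ) (θ : Icc (-(r : ℝ)) 0) :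
    history r x t θ = x (t + θ) := rfl

theorem history_now (x : C(ℝ, Vec n)) (t : ℝ) : (history r x t).now = x t := by
  simp [Hist.now, history_apply]

theorem continuous_history (x : C(ℝ, Vec n)) : Continuous (history r x) := by
  refine ContinuousMap.continuous_of_continuous_uncurry _ ?_
  exact x.continuous.comp (by fun_prop)

theorem norm_history_le {x : C(ℝ, Vec n)} {t B : ℝ} (hB : 0 ≤ B)
    (h : ∀ s ∈ Icc (t - r) t, ‖x s‖ ≤ B) : ‖history r x t‖ ≤ B := by
  refine (ContinuousMap.norm_le _ hB).2 fun θ => h _ ?_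
  have := θ.2
  constructor <;> linarith [this.1, this.2]

theorem norm_le_norm_history (x : C(ℝ, Vec n)) {s t : ℝ} (h : s ∈ Icc (t - r) t) :
    ‖x s‖ ≤ ‖history r x t‖ := by
  have := (history r x t).norm_coe_le_norm ⟨s - t, by linarith [h.1], by linarith [h.2]⟩
  simpa [history_apply] using this

theorem norm_history_sub_le {x y : C(ℝ, Vec n)} {t t' B : ℝ} (hB : 0 ≤ B)
    (h : ∀ θ ∈ Icc (-(r : ℝ)) 0, ‖x (t + θ) - y (t' + θ)‖ ≤ B) :
    ‖history r x t - history r y t'‖ ≤ B :=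
  (ContinuousMap.norm_le _ hB).2 fun θ => h θ θ.2

theorem history_congr {x y : C(ℝ, Vec n)} {t : ℝ} (h : ∀ s ∈ Icc (t - r) t, x s = y s) :
    history r x t = history r y t := by
  ext1 θ
  have := θ.2
  exact h _ ⟨by linarith [this.1], by linarith [this.2]⟩

theorem history_sub (x y : C(ℝ, Vec n)) (t : ℝ) :
    history r (x - y) t = history r x t - history r y t := rfl

/-! ### Grönwall's inequality in integral form -/

/-- The right-hand side u is differentiable although m is only continuous, and u' = K m + ε ≤ K u +
ε, so the differential form of Grönwall's inequality applies to u. -/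
theorem le_gronwallBound_of_le_integral {m : ℝ → ℝ} (hm : Continuous m) {a b c K ε : ℝ}
    (hK : 0 ≤ K) (h : ∀ t ∈ Icc a b, m t ≤ c + ∫ s in a..t, (K * m s + ε)) :
    ∀ t ∈ Icc a b, m t ≤ gronwallBound c K ε (t - a) := by
  let u : ℝ → ℝ := fun t => c + ∫ s in a..t, (K * m s + ε)
  have hu : ∀ t, HasDerivAt u (K * m t + ε) t := fun t => by
    have hc : Continuous fun s => K * m s + ε := by fun_prop
    exact (intervalIntegral.integral_hasDerivAt_right (hc.intervalIntegrable _ _)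
      hc.aestronglyMeasurable.stronglyMeasurableAtFilter hc.continuousAt).const_add c
  intro t ht
  refine (h t ht).trans ?_
  refine le_gronwallBound_of_liminf_deriv_right_le (f := u) (f' := fun t => K * m t + ε)
    (b := b) (fun t _ => (hu t).continuousAt.continuousWithinAt) ?_ (by simp [u]) ?_ t ht
  · intro t _ q hq
    have := (hu t).hasDerivWithinAt (s := Ici t) |>.liminf_right_slope_le hq
    refine this.mono fun z hz => ?_
    simpa [slope_def_field, div_eq_inv_mul] using hz
  · intro t ht
    have := mul_le_mul_of_nonneg_left (h t ⟨ht.1, ht.2.le⟩) hK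
    simp only [u]
    linarith

/-! ### Retarded equations with a bounded one-sided Lipschitz right-hand side -/

/-- A bounded Carathéodory field on histories that satisfies a one-sided Lipschitz condition. -/
structure BoundedField (F : ℝ → Hist r n → Vec n) (C L : ℝ) : Prop where
  meas : ∀ ξ : ℝ → Hist r n, Continuous ξ → AEStronglyMeasurable (fun t => F t (ξ t)) volume
  bound : ∀ t x, ‖F t x‖ ≤ C
  nonneg : 0 ≤ L
  osl : ∀ t x y, inner ℝ (x.now - y.now) (F t x - F t y) ≤ L * ‖x - y‖ ^ 2
  cont : ∀ t, Continuous (F t)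

namespace BoundedField

variable {F : ℝ → Hist r n → Vec n} {C L : ℝ}

theorem bound_nonneg (hF : BoundedField F C L) : 0 ≤ C := (norm_nonneg _).trans (hF.bound 0 0)

theorem intervalIntegrable (hF : BoundedField F C L) {ξ : ℝ → Hist r n} (hξ : Continuous ξ)
    (a b : ℝ) : IntervalIntegrable (fun t => F t (ξ t)) volume a b :=
  (intervalIntegrable_const (c := C)).mono_fun (hF.meas ξ hξ).restrict
    (.of_forall fun t => (hF.bound t _).trans (le_abs_self C))

/-- The primitive of a bounded field along a curve is Lipschitz. -/
theorem norm_integral_sub_le (hF : BoundedField F C L) {ξ : ℝ → Hist r n} (hξ : Continuous ξ)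
    (a s t : ℝ) :
    ‖(∫ τ in a..t, F τ (ξ τ)) - ∫ τ in a..s, F τ (ξ τ)‖ ≤ C * |t - s| := by
  rw [intervalIntegral.integral_interval_sub_left (hF.intervalIntegrable hξ _ _)
    (hF.intervalIntegrable hξ _ _)]
  exact intervalIntegral.norm_integral_le_of_norm_le_const fun τ _ => hF.bound τ _

theorem continuous_integral (hF : BoundedField F C L) {ξ : ℝ → Hist r n} (hξ : Continuous ξ)
    (a : ℝ) : Continuous fun t => ∫ τ in a..t, F τ (ξ τ) :=
  intervalIntegral.continuous_primitive (fun _ _ => hF.intervalIntegrable hξ _ _) a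

/-- Two approximate solutions of the same equation stay close to each other. -/
theorem compare (hF : BoundedField F C L) {t₀ T e : ℝ} (he : 0 ≤ e)
    {x y : C(ℝ, Vec n)} {ξ η : ℝ → Hist r n} (hξ : Continuous ξ) (hη : Continuous η)
    (hx : ∀ t ∈ Icc t₀ T, x t = x t₀ + ∫ s in t₀..t, F s (ξ s))
    (hy : ∀ t ∈ Icc t₀ T, y t = y t₀ + ∫ s in t₀..t, F s (η s))
    (hxξ : ∀ t ∈ Icc t₀ T, ‖ξ t - history r x t‖ ≤ e)
    (hyη : ∀ t ∈ Icc t₀ T, ‖η t - history r y t‖ ≤ e) :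
    ∀ t ∈ Icc t₀ T, ‖history r x t - history r y t‖ ^ 2 ≤
      gronwallBound (‖history r x t₀ - history r y t₀‖ ^ 2) (4 * L)
        (16 * L * e ^ 2 + 8 * C * e) (t - t₀) := by
  have hC := hF.bound_nonneg
  have hL := hF.nonneg
  -- This collects the errors in the derivative of ‖w‖², which is twice an inner product: 2L(a +
  -- 2e)² ≤ 4La² + 16Le², and 2 · 2e · 2C = 8Ce.
  set ε := 16 * L * e ^ 2 + 8 * C * e with hε
  have hε0 : 0 ≤ ε := by positivity
  set w : C(ℝ, Vec n) := x - y
  set m : ℝ → ℝ := fun t => ‖history r w t‖ ^ 2 with hm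
  have hmc : Continuous m := (continuous_history w).norm.pow 2
  have hm0 : ∀ t, 0 ≤ m t := fun t => by positivity
  have hkc : Continuous fun s => 4 * L * m s + ε := by fun_prop
  let g : ℝ → Vec n := fun s => F s (ξ s) - F s (η s)
  have hgi : ∀ a b, IntervalIntegrable g volume a b := fun a b =>
    (hF.intervalIntegrable hξ a b).sub (hF.intervalIntegrable hη a b)
  have hgb : ∀ s, ‖g s‖ ≤ 2 * C := fun s => by
    calc ‖g s‖ ≤ ‖F s (ξ s)‖ + ‖F s (η s)‖ := norm_sub_le _ _
      _ ≤ 2 * C := by linarith [hF.bound s (ξ s), hF.bound s (η s)]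
  -- A globally Lipschitz curve that agrees with w on [t₀, T] and can be differentiated at the
  -- endpoints as well.
  let z : ℝ → Vec n := fun t => w t₀ + ∫ s in t₀..t, g s
  have hzw : ∀ t ∈ Icc t₀ T, z t = w t := fun t ht => by
    simp only [z, w, g, ContinuousMap.sub_apply]
    rw [intervalIntegral.integral_sub (hF.intervalIntegrable hξ _ _)
      (hF.intervalIntegrable hη _ _), hx t ht, hy t ht]
    abel
  have hzlip : LipschitzWith (2 * C).toNNReal z := by
    refine LipschitzWith.of_dist_le_mul fun s t => ?_
    rw [dist_eq_norm, Real.coe_toNNReal _ (by positivity), Real.dist_eq]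
    simp only [z, add_sub_add_left_eq_sub]
    rw [intervalIntegral.integral_interval_sub_left (hgi _ _) (hgi _ _)]
    exact intervalIntegral.norm_integral_le_of_norm_le_const fun τ _ => hgb τ
  have hstep : ∀ t ∈ Icc t₀ T, ‖w t‖ ^ 2 ≤ m t₀ + ∫ s in t₀..t, (4 * L * m s + ε) := by
    intro t ht
    have hac : AbsolutelyContinuousOnInterval (fun s => ‖z s‖ ^ 2) t₀ t := by
      have h1 : AbsolutelyContinuousOnInterval (fun s => ‖z s‖) t₀ t :=
        (LipschitzWith.comp lipschitzWith_one_norm hzlip).lipschitzOnWith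
          |>.absolutelyContinuousOnInterval
      have := h1.mul h1
      refine this.congr' (.of_forall fun E => ?_)
      simp [pow_two]
    have key := sub_le_integral_of_deriv_le ht.1 hac (hkc.intervalIntegrable _ _) (by
      filter_upwards [(hgi t₀ t).ae_hasDerivAt_integral] with s hs hst
      have hst' : s ∈ Icc t₀ T := ⟨hst.1, hst.2.trans ht.2⟩
      have hd : HasDerivAt z (g s) s :=
        (hs (by rwa [uIcc_of_le ht.1]) t₀ (by simp)).const_add _
      rw [hd.norm_sq.deriv, hzw s hst']
      have hW : ‖history r w s‖ = ‖history r x s - history r y s‖ := rfl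
      set p := ξ s - history r x s with hp
      set q := η s - history r y s with hq
      have hpe := hxξ s hst'
      have hqe := hyη s hst'
      -- The one-sided condition tests against the present values of ξ and η, whereas the derivative
      -- of ‖w‖² contains the present values of x and y. The discrepancy has norm at most 2e and is
      -- paired with g, which is bounded by 2C.
      have hdec : w s = ((ξ s).now - (η s).now) - (p.now - q.now) := by
        simp only [hp, hq, Hist.now_sub, history_now, w, ContinuousMap.sub_apply]
        abel
      have hn : ‖ξ s - η s‖ ≤ ‖history r w s‖ + 2 * e := by
        have : ξ s - η s = history r w s + (p - q) := by
          rw [history_sub, hp, hq]; abel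
        rw [this]
        refine (norm_add_le _ _).trans ?_
        linarith [norm_sub_le p q]
      have hpq : ‖p.now - q.now‖ ≤ 2 * e := by
        refine (norm_sub_le _ _).trans ?_
        linarith [p.norm_now_le, q.norm_now_le]
      have h1 : inner ℝ ((ξ s).now - (η s).now) (g s) ≤ L * (‖history r w s‖ + 2 * e) ^ 2 := by
        refine (hF.osl s (ξ s) (η s)).trans ?_
        gcongr
      have h2 : -inner ℝ (p.now - q.now) (g s) ≤ 2 * e * (2 * C) := by
        refine (neg_le_abs _).trans ((abs_real_inner_le_norm _ _).trans ?_)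
        exact mul_le_mul hpq (hgb s) (norm_nonneg _) (by positivity)
      rw [hdec, inner_sub_left]
      have h3 : L * (‖history r w s‖ + 2 * e) ^ 2 ≤ L * (2 * ‖history r w s‖ ^ 2 + 8 * e ^ 2) := by
        gcongr
        nlinarith [sq_nonneg (‖history r w s‖ - 2 * e)]
      simp only [hm, hε]
      linarith)
    have ht₀ : t₀ ∈ Icc t₀ T := ⟨le_rfl, ht.1.trans ht.2⟩
    simp only [hzw t ht, hzw t₀ ht₀] at key
    have hw0 : ‖w t₀‖ ^ 2 ≤ m t₀ := by
      have := norm_le_norm_history (r := r) w (s := t₀) (t := t₀) ⟨by simp, le_rfl⟩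
      simp only [hm]
      gcongr
    linarith
  refine le_gronwallBound_of_le_integral (m := m) hmc (by positivity) fun t ht => ?_
  -- The integrand is nonnegative, so the bound at time t dominates those at earlier times and hence
  -- the whole history; on the part of the window before t₀ the term m t₀ suffices.
  have hi0 : ∀ s ∈ Icc t₀ t, ∫ τ in t₀..s, (4 * L * m τ + ε) ≤ ∫ τ in t₀..t, (4 * L * m τ + ε) := by
    intro s hs
    refine intervalIntegral.integral_mono_interval le_rfl hs.1 hs.2
      (.of_forall fun τ => ?_) (hkc.intervalIntegrable _ _)
    have := hm0 τ
    simp only [Pi.zero_apply]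
    positivity
  have hi1 : 0 ≤ ∫ τ in t₀..t, (4 * L * m τ + ε) := by
    simpa using hi0 t₀ ⟨le_rfl, ht.1⟩
  have hB : 0 ≤ m t₀ + ∫ s in t₀..t, (4 * L * m s + ε) := add_nonneg (hm0 _) hi1
  change ‖history r w t‖ ^ 2 ≤ m t₀ + _
  rw [← Real.le_sqrt (norm_nonneg _) hB]
  refine norm_history_le (Real.sqrt_nonneg _) fun s hs => Real.le_sqrt_of_sq_le ?_
  rcases le_total s t₀ with hst | hst
  · have := norm_le_norm_history (r := r) w (s := s) (t := t₀) ⟨by linarith [hs.1, ht.1], hst⟩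
    have : ‖w s‖ ^ 2 ≤ m t₀ := by simp only [hm]; gcongr
    linarith
  · linarith [hstep s ⟨hst, hs.2.trans ht.2⟩, hi0 s ⟨hst, hs.2⟩]

end BoundedField

end RFDE

/-! ### Existence and continuous dependence for bounded fields -/

namespace RFDE

variable {r : ℝ≥0} {n : ℕ}

namespace BoundedField

variable {F : ℝ → Hist r n → Vec n} {C L : ℝ}

/-- The integral operator of the retarded equation, with its right-hand side delayed by `ε`. -/
noncomputable def delayOp (hF : BoundedField F C L) (t₀ : ℝ) (x₀ : Hist r n) (ε : ℝ)
    (X : C(ℝ, Vec n)) : C(ℝ, Vec n) where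
  toFun t := x₀.ext (t - t₀) + ∫ s in t₀..max t t₀, F s (history r X (s - ε))
  continuous_toFun := by
    have hξ : Continuous fun s => history r X (s - ε) := (continuous_history X).comp (by fun_prop)
    exact (x₀.continuous_ext.comp (by fun_prop)).add
      ((hF.continuous_integral hξ t₀).comp (by fun_prop))

theorem delayOp_apply (hF : BoundedField F C L) (t₀ : ℝ) (x₀ : Hist r n) (ε : ℝ)
    (X : C(ℝ, Vec n)) (t : ℝ) : delayOp hF t₀ x₀ ε X t =
      x₀.ext (t - t₀) + ∫ s in t₀..max t t₀, F s (history r X (s - ε)) := rfl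

theorem delayOp_of_le (hF : BoundedField F C L) {t₀ : ℝ} (x₀ : Hist r n) (ε : ℝ)
    (X : C(ℝ, Vec n)) {t : ℝ} (ht : t ≤ t₀) : delayOp hF t₀ x₀ ε X t = x₀.ext (t - t₀) := by
  simp [delayOp_apply, ht]

/-- At time s the integrand looks at the trajectory only up to s - ε, so each application of the
operator enlarges the interval of agreement by ε. -/
theorem delayOp_eqOn (hF : BoundedField F C L) {t₀ : ℝ} (x₀ : Hist r n) {ε : ℝ} (hε : 0 < ε)
    {X Y : C(ℝ, Vec n)} {a : ℝ} (ha : t₀ ≤ a) (h : EqOn X Y (Iic a)) :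
    EqOn (delayOp hF t₀ x₀ ε X) (delayOp hF t₀ x₀ ε Y) (Iic (a + ε)) := by
  intro t ht
  rw [delayOp_apply, delayOp_apply]
  congr 1
  refine intervalIntegral.integral_congr fun s hs => ?_
  rw [uIcc_of_le (le_max_right _ _)] at hs
  have hsa : s ≤ a + ε := hs.2.trans (max_le ht (by linarith))
  rw [history_congr (x := X) (y := Y)]
  intro τ hτ
  exact h (show τ ≤ a by linarith [hτ.2])

/-- The equation with delayed right-hand side can be solved step by step. -/
theorem exists_delayed_solution (hF : BoundedField F C L) (t₀ T : ℝ) (x₀ : Hist r n) {ε : ℝ}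
    (hε : 0 < ε) : ∃ X : C(ℝ, Vec n), EqOn X (delayOp hF t₀ x₀ ε X) (Iic T) := by
  let base : C(ℝ, Vec n) := ⟨fun t => x₀.ext (t - t₀), x₀.continuous_ext.comp (by fun_prop)⟩
  let X : ℕ → C(ℝ, Vec n) := fun j => (delayOp hF t₀ x₀ ε)^[j] base
  have hX : ∀ j, X (j + 1) = delayOp hF t₀ x₀ ε (X j) := fun j =>
    Function.iterate_succ_apply' _ _ _
  have key : ∀ j : ℕ, EqOn (X j) (X (j + 1)) (Iic (t₀ + j * ε)) := by
    intro j
    induction j with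
    | zero =>
      intro t ht
      rw [hX, delayOp_of_le hF x₀ ε _ (by simpa using ht)]
      rfl
    | succ j ih =>
      have := delayOp_eqOn hF x₀ hε (le_add_of_nonneg_right (by positivity)) ih
      rw [← hX, ← hX] at this
      refine this.mono (Iic_subset_Iic.2 ?_)
      push_cast
      linarith
  obtain ⟨j, hj⟩ := exists_nat_ge ((T - t₀) / ε)
  rw [div_le_iff₀ hε] at hj
  refine ⟨X j, ?_⟩
  rw [← hX]
  exact (key j).mono (Iic_subset_Iic.2 (by linarith))

/-- The modulus of continuity does not depend on the delay: the initial history is uniformly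
continuous and the integral term is C-Lipschitz. -/
theorem delayed_modulus (hF : BoundedField F C L) (x₀ : Hist r n) {η : ℝ} (hη : 0 < η) :
    ∃ δ > 0, ∀ (t₀ T ε : ℝ) (X : C(ℝ, Vec n)), EqOn X (delayOp hF t₀ x₀ ε X) (Iic T) →
      ∀ s t, s ≤ T → t ≤ T → |t - s| ≤ δ → ‖X t - X s‖ ≤ η := by
  have hC := hF.bound_nonneg
  obtain ⟨δ, hδ, h⟩ := Metric.uniformContinuous_iff.1 x₀.uniformContinuous_ext (η / 2) (by positivity)
  refine ⟨min (δ / 2) (η / (2 * (C + 1))), by positivity, ?_⟩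
  intro t₀ T ε X hX s t hs ht hst
  have hξ : Continuous fun s => history r X (s - ε) := (continuous_history X).comp (by fun_prop)
  rw [hX hs, hX ht, delayOp_apply, delayOp_apply, add_sub_add_comm]
  have h1 : ‖x₀.ext (t - t₀) - x₀.ext (s - t₀)‖ ≤ η / 2 := by
    rw [← dist_eq_norm]
    refine (h ?_).le
    rw [Real.dist_eq, sub_sub_sub_cancel_right]
    linarith [hst.trans (min_le_left _ _)]
  have h2 := hF.norm_integral_sub_le hξ t₀ (max s t₀) (max t t₀)
  have h3 : |max t t₀ - max s t₀| ≤ |t - s| := abs_max_sub_max_le_abs _ _ _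
  have h4 : C * |max t t₀ - max s t₀| ≤ η / 2 := by
    calc C * |max t t₀ - max s t₀| ≤ (C + 1) * (η / (2 * (C + 1))) := by
          gcongr
          · linarith
          · exact h3.trans (hst.trans (min_le_right _ _))
      _ = η / 2 := by field_simp
  exact (norm_add_le _ _).trans (by linarith)

/-- Existence of solutions of retarded equations with a bounded one-sided Lipschitz field. -/
theorem exists_solution (hF : BoundedField F C L) {t₀ T : ℝ} (hT : t₀ ≤ T) (x₀ : Hist r n) :
    ∃ x : C(ℝ, Vec n), (∀ t ≤ t₀, x t = x₀.ext (t - t₀)) ∧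
      ∀ t ∈ Icc t₀ T, x t = x t₀ + ∫ s in t₀..t, F s (history r x s) := by
  have hC := hF.bound_nonneg
  have hL := hF.nonneg
  let ε : ℕ → ℝ := fun j => 1 / (j + 1)
  have hε : ∀ j, 0 < ε j := fun j => Nat.one_div_pos_of_nat
  have hε0 : Tendsto ε atTop (𝓝 0) := tendsto_one_div_add_atTop_nhds_zero_nat
  choose X hX using fun j => hF.exists_delayed_solution t₀ T x₀ (hε j)
  have hXinit : ∀ j, ∀ t ≤ t₀, X j t = x₀.ext (t - t₀) := fun j t ht => by
    rw [hX j (show t ≤ T from ht.trans hT), delayOp_of_le hF x₀ _ _ ht]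
  have hXint : ∀ j, ∀ t ∈ Icc t₀ T,
      X j t = X j t₀ + ∫ s in t₀..t, F s (history r (X j) (s - ε j)) := fun j t ht => by
    rw [hX j (show t ≤ T from ht.2), delayOp_apply, hXinit j t₀ le_rfl, max_eq_left ht.1, sub_self,
      Hist.ext_of_nonneg _ (sub_nonneg.2 ht.1), x₀.ext_zero]
  have hmod : ∀ η > 0, ∀ᶠ j in atTop, ∀ s ≤ T,
      ‖history r (X j) (s - ε j) - history r (X j) s‖ ≤ η := by
    intro η hη
    obtain ⟨δ, hδ, h⟩ := hF.delayed_modulus x₀ hη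
    filter_upwards [hε0.eventually (Iic_mem_nhds hδ)] with j hj s hs
    refine norm_history_sub_le hη.le fun θ hθ => ?_
    refine h t₀ T (ε j) (X j) (hX j) _ _ (by linarith [hθ.2]) (by linarith [hθ.2, hε j]) ?_
    rw [show s - ε j + θ - (s + θ) = -ε j by ring, abs_neg, abs_of_pos (hε j)]
    exact hj
  have hξ : ∀ j, Continuous fun s => history r (X j) (s - ε j) := fun j =>
    (continuous_history _).comp (by fun_prop)
  -- No compactness is available from the one-sided condition alone, nor is it needed: the initial
  -- histories coincide, so `compare` bounds the squared distance by a Grönwall bound whose only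
  -- source is the delay error, and this tends to 0 with η.
  have hcauchy : ∀ e > 0, ∃ N, ∀ i ≥ N, ∀ j ≥ N, ∀ t ≤ T, ‖X i t - X j t‖ < e := by
    intro e he
    let B : ℝ → ℝ := fun η => gronwallBound 0 (4 * L) (16 * L * η ^ 2 + 8 * C * η) (T - t₀)
    have hB : Tendsto B (𝓝[>] 0) (𝓝 0) := by
      have hc : Continuous B := (gronwallBound_continuous_ε 0 (4 * L) (T - t₀)).comp
        (by fun_prop : Continuous fun η : ℝ => 16 * L * η ^ 2 + 8 * C * η)
      have := hc.tendsto 0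
      simp only [B] at this
      norm_num [gronwallBound_ε0_δ0] at this
      exact this.mono_left nhdsWithin_le_nhds
    obtain ⟨η, hη1, hη⟩ := ((hB.eventually (Iio_mem_nhds (by positivity : (0 : ℝ) < e ^ 2))).and
      self_mem_nhdsWithin).exists
    have hη' : 0 < η := hη
    obtain ⟨N, hN⟩ := eventually_atTop.1 (hmod η hη')
    refine ⟨N, fun i hi j hj t ht => ?_⟩
    rcases le_total t t₀ with h | h
    · rw [hXinit i t h, hXinit j t h, sub_self, norm_zero]
      exact he
    have := hF.compare hη'.le (hξ i) (hξ j) (hXint i) (hXint j) (fun s hs => hN i hi s hs.2)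
      (fun s hs => hN j hj s hs.2) t ⟨h, ht⟩
    have h0 : history r (X i) t₀ - history r (X j) t₀ = 0 := by
      rw [sub_eq_zero]
      refine history_congr fun s hs => ?_
      rw [hXinit i s hs.2, hXinit j s hs.2]
    rw [h0, norm_zero, zero_pow two_ne_zero] at this
    have hmono : gronwallBound 0 (4 * L) (16 * L * η ^ 2 + 8 * C * η) (t - t₀) ≤ B η :=
      gronwallBound_mono le_rfl (by positivity) (by positivity) (by linarith)
    have hlt : ‖history r (X i) t - history r (X j) t‖ < e :=
      lt_of_pow_lt_pow_left₀ 2 he.le ((this.trans hmono).trans_lt hη1)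
    refine lt_of_le_of_lt ?_ hlt
    exact norm_le_norm_history (r := r) (X i - X j) (s := t) (t := t) ⟨by simp, le_rfl⟩
  -- Freezing time at T makes the convergence uniform on the whole line, so the limit is a globally
  -- continuous curve.
  let Y : ℕ → ℝ → Vec n := fun j t => X j (min t T)
  have hYc : ∀ j, Continuous (Y j) := fun j => (X j).continuous.comp (by fun_prop)
  have hYcauchy : UniformCauchySeqOn Y atTop univ := by
    rw [Metric.uniformCauchySeqOn_iff]
    intro e he
    obtain ⟨N, hN⟩ := hcauchy e he
    exact ⟨N, fun i hi j hj t _ => by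
      rw [dist_eq_norm]; exact hN i hi j hj _ (min_le_right _ _)⟩
  choose y hy using fun t => cauchySeq_tendsto_of_complete (hYcauchy.cauchySeq (mem_univ t))
  have hunif : TendstoUniformly Y y atTop := by
    rw [← tendstoUniformlyOn_univ]
    exact hYcauchy.tendstoUniformlyOn_of_tendsto fun t _ => hy t
  let x : C(ℝ, Vec n) := ⟨y, hunif.continuous (.of_forall hYc)⟩
  have hxX : ∀ t ≤ T, Tendsto (fun j => X j t) atTop (𝓝 (x t)) := fun t ht => by
    have : Tendsto (fun j => X j t) atTop (𝓝 (y t)) := by simpa [Y, ht] using hy t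
    exact this
  have hinit : ∀ t ≤ t₀, x t = x₀.ext (t - t₀) := fun t ht =>
    tendsto_nhds_unique (hxX t (ht.trans hT)) (by simp [hXinit _ t ht])
  have hhist : ∀ s ≤ T, Tendsto (fun j => history r (X j) (s - ε j)) atTop (𝓝 (history r x s)) := by
    intro s hs
    rw [Metric.tendsto_nhds]
    intro e he
    filter_upwards [hmod (e / 3) (by positivity),
      Metric.tendstoUniformly_iff.1 hunif (e / 3) (by positivity)] with j h1 h2
    rw [dist_eq_norm]
    have h3 : ‖history r (X j) s - history r x s‖ ≤ e / 3 := by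
      refine norm_history_sub_le (by positivity) fun θ hθ => ?_
      have := (h2 (s + θ)).le
      rwa [dist_comm, dist_eq_norm, show Y j (s + θ) = X j (s + θ) by
        simp only [Y]; rw [min_eq_left (by linarith [hθ.2])]] at this
    calc _ = ‖(history r (X j) (s - ε j) - history r (X j) s)
          + (history r (X j) s - history r x s)‖ := by rw [sub_add_sub_cancel]
      _ ≤ e / 3 + e / 3 := (norm_add_le _ _).trans (add_le_add (h1 s hs) h3)
      _ < e := by linarith
  refine ⟨x, hinit, fun t ht => ?_⟩
  have hlim : Tendsto (fun j => ∫ s in t₀..t, F s (history r (X j) (s - ε j))) atTop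
      (𝓝 (∫ s in t₀..t, F s (history r x s))) := by
    refine intervalIntegral.tendsto_integral_filter_of_dominated_convergence (fun _ => C)
      (.of_forall fun j => (hF.meas _ (hξ j)).restrict)
      (.of_forall fun j => .of_forall fun s _ => hF.bound s _) intervalIntegrable_const
      (.of_forall fun s hs => ?_)
    rw [uIoc_of_le ht.1] at hs
    exact ((hF.cont s).tendsto _).comp (hhist s (hs.2.trans ht.2))
  refine tendsto_nhds_unique (hxX t ht.2) ?_
  simp_rw [hXint _ t ht]
  exact (hxX t₀ hT).add hlim

end BoundedField

/-! ### Integral and differential form of the equation -/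

/-- `x` solves `ẋ(t) = F(t, T_r(t)x)` almost everywhere on `[t₀, T]`. -/
structure SolvesOn (F : ℝ → Hist r n → Vec n) (t₀ T : ℝ) (x : C(ℝ, Vec n)) : Prop where
  absCont : AbsolutelyContinuousOnInterval x t₀ T
  ode : ∀ᵐ t, t ∈ Icc t₀ T → HasDerivAt x (F t (history r x t)) t

theorem SolvesOn.mono {F : ℝ → Hist r n → Vec n} {t₀ T t : ℝ} {x : C(ℝ, Vec n)}
    (h : SolvesOn F t₀ T x) (ht : t ∈ Icc t₀ T) : SolvesOn F t₀ t x :=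
  ⟨h.absCont.mono (by rw [uIcc_of_le ht.1, uIcc_of_le (ht.1.trans ht.2)]
                      exact Icc_subset_Icc_right ht.2),
    h.ode.mono fun _ hs hst => hs ⟨hst.1, hst.2.trans ht.2⟩⟩

namespace BoundedField

variable {F : ℝ → Hist r n → Vec n} {C L : ℝ}

theorem lipschitzOn_of_integral (hF : BoundedField F C L) {t₀ T : ℝ}
    {x : C(ℝ, Vec n)} (hx : ∀ t ∈ Icc t₀ T, x t = x t₀ + ∫ s in t₀..t, F s (history r x s)) :
    LipschitzOnWith C.toNNReal x (Icc t₀ T) := by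
  refine LipschitzOnWith.of_dist_le_mul fun t ht s hs => ?_
  rw [dist_eq_norm, hx s hs, hx t ht, add_sub_add_left_eq_sub, Real.dist_eq,
    Real.coe_toNNReal _ hF.bound_nonneg]
  exact hF.norm_integral_sub_le (continuous_history x) _ _ _

theorem solvesOn_of_integral (hF : BoundedField F C L) {t₀ T : ℝ} (hT : t₀ ≤ T)
    {x : C(ℝ, Vec n)} (hx : ∀ t ∈ Icc t₀ T, x t = x t₀ + ∫ s in t₀..t, F s (history r x s)) :
    SolvesOn F t₀ T x := by
  refine ⟨lipschitzOn_absCont hT (hF.lipschitzOn_of_integral hx), ?_⟩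
  have h1 : ∀ᵐ t : ℝ, t ≠ t₀ := by simp [ae_iff]
  have h2 : ∀ᵐ t : ℝ, t ≠ T := by simp [ae_iff]
  filter_upwards [(hF.intervalIntegrable (continuous_history x) t₀ T).ae_hasDerivAt_integral,
    h1, h2] with t ht ht1 ht2 htm
  have hd : HasDerivAt (fun t => x t₀ + ∫ s in t₀..t, F s (history r x s))
      (F t (history r x t)) t := (ht (by rwa [uIcc_of_le hT]) t₀ (by simp)).const_add _
  refine hd.congr_of_eventuallyEq ?_
  filter_upwards [Icc_mem_nhds (lt_of_le_of_ne htm.1 (Ne.symm ht1)) (lt_of_le_of_ne htm.2 ht2)]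
    with s hs using hx s hs

/-- The difference between x and the primitive z is absolutely continuous with zero derivative
almost everywhere, hence constant. -/
theorem integral_of_solvesOn (hF : BoundedField F C L) {t₀ T : ℝ} (hT : t₀ ≤ T)
    {x : C(ℝ, Vec n)} (hx : SolvesOn F t₀ T x) :
    ∀ t ∈ Icc t₀ T, x t = x t₀ + ∫ s in t₀..t, F s (history r x s) := by
  let z : ℝ → Vec n := fun t => ∫ s in t₀..t, F s (history r x s)
  have hz : LipschitzWith C.toNNReal z := LipschitzWith.of_dist_le_mul fun t s => by
    rw [dist_eq_norm, Real.dist_eq, Real.coe_toNNReal _ hF.bound_nonneg]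
    exact hF.norm_integral_sub_le (continuous_history x) _ _ _
  have hac : AbsolutelyContinuousOnInterval (fun t => x t - z t) t₀ T :=
    hx.absCont.sub hz.lipschitzOnWith.absolutelyContinuousOnInterval
  obtain ⟨c, hc⟩ := hac.const_of_ae_hasDerivAt_zero (by
    filter_upwards [(hF.intervalIntegrable (continuous_history x) t₀ T).ae_hasDerivAt_integral,
      hx.ode] with t ht hxt htm
    rw [← sub_self (F t (history r x t))]
    exact (hxt (by rwa [uIcc_of_le hT] at htm)).sub (ht htm t₀ (by simp)))
  rw [uIcc_of_le hT] at hc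
  intro t ht
  have h1 := hc t ht
  have h2 := hc t₀ ⟨le_rfl, hT⟩
  have h3 : z t₀ = 0 := by simp [z]
  rw [h3, sub_zero] at h2
  rw [h2, ← h1]
  simp [z]

/-- Continuous dependence on the initial history. -/
theorem norm_history_sub_le_exp (hF : BoundedField F C L) {t₀ T : ℝ} {x y : C(ℝ, Vec n)}
    (hx : SolvesOn F t₀ T x) (hy : SolvesOn F t₀ T y) {t : ℝ} (ht : t ∈ Icc t₀ T) :
    ‖history r x t - history r y t‖ ≤
      ‖history r x t₀ - history r y t₀‖ * Real.exp (2 * L * (t - t₀)) := by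
  have hT := ht.1.trans ht.2
  have := hF.compare le_rfl (continuous_history x) (continuous_history y)
    (hF.integral_of_solvesOn hT hx) (hF.integral_of_solvesOn hT hy) (by simp) (by simp) t ht
  norm_num [gronwallBound_ε0] at this
  refine le_of_sq_le_sq ?_ (by positivity)
  rw [mul_pow, ← Real.exp_nat_mul]
  refine this.trans_eq ?_
  congr 2
  push_cast
  ring

end BoundedField

end RFDE

/-! ### Reduction of the control system to bounded fields -/

namespace RFDE

variable {r : ℝ≥0} {n l m k k₁ : ℕ}

/-! ### Truncation of the control system -/

/-- A Lipschitz cutoff: `1` on the ball of radius `N`, `0` outside the ball of radius `N + 1`. -/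
noncomputable def cutoff (N : ℝ) (x : Hist r n) : ℝ := max 0 (min 1 (N + 1 - ‖x‖))

theorem cutoff_nonneg (N : ℝ) (x : Hist r n) : 0 ≤ cutoff N x := le_max_left _ _

theorem cutoff_le_one (N : ℝ) (x : Hist r n) : cutoff N x ≤ 1 :=
  max_le zero_le_one (min_le_left _ _)

theorem cutoff_of_le {N : ℝ} {x : Hist r n} (h : ‖x‖ ≤ N) : cutoff N x = 1 := by
  rw [cutoff, min_eq_left (by linarith), max_eq_right zero_le_one]

theorem cutoff_of_ge {N : ℝ} {x : Hist r n} (h : N + 1 ≤ ‖x‖) : cutoff N x = 0 :=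
  max_eq_left ((min_le_right _ _).trans (by linarith))

theorem continuous_cutoff (N : ℝ) : Continuous (cutoff N : Hist r n → ℝ) := by
  unfold cutoff
  fun_prop

theorem abs_cutoff_sub_le (N : ℝ) (x y : Hist r n) : |cutoff N x - cutoff N y| ≤ ‖x - y‖ := by
  unfold cutoff
  rw [max_comm 0, max_comm 0, min_comm 1, min_comm 1]
  refine (abs_max_sub_max_le_abs _ _ _).trans ((abs_min_sub_min_le_max _ _ _ _).trans ?_)
  rw [sub_self, abs_zero, sub_sub_sub_cancel_left, max_eq_left (abs_nonneg _), abs_sub_comm]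
  exact abs_norm_sub_norm_le x y

theorem cutoff_smul_bound {N C : ℝ} (hC : 0 ≤ C) {φ : Hist r n → Vec n}
    (hφ : ∀ x, ‖x‖ ≤ N + 1 → ‖φ x‖ ≤ C) (x : Hist r n) : ‖cutoff N x • φ x‖ ≤ C := by
  rcases le_total ‖x‖ (N + 1) with h | h
  · rw [norm_smul, Real.norm_of_nonneg (cutoff_nonneg _ _)]
    calc _ ≤ 1 * C := mul_le_mul (cutoff_le_one _ _) (hφ x h) (norm_nonneg _) zero_le_one
      _ = C := one_mul C
  · simpa [cutoff_of_ge h] using hC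

/-- The cutoff is 1-Lipschitz and φ is bounded by C on the larger ball, so varying the cutoff costs
at most C‖x - y‖². If one of the histories lies outside that ball, its term vanishes and the cutoff
at the other one is itself at most ‖x - y‖. -/
theorem inner_cutoff_smul_sub_le {N C L : ℝ} (hC : 0 ≤ C) (hL : 0 ≤ L) {φ : Hist r n → Vec n}
    (hφ : ∀ x, ‖x‖ ≤ N + 1 → ‖φ x‖ ≤ C)
    (hosl : ∀ x y, ‖x‖ ≤ N + 1 → ‖y‖ ≤ N + 1 →
      inner ℝ (x.now - y.now) (φ x - φ y) ≤ L * ‖x - y‖ ^ 2) (x y : Hist r n) :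
    inner ℝ (x.now - y.now) (cutoff N x • φ x - cutoff N y • φ y) ≤ (L + C) * ‖x - y‖ ^ 2 := by
  have hnow : ‖x.now - y.now‖ ≤ ‖x - y‖ := (x - y).norm_now_le
  have hmul : ∀ z, ‖z‖ ≤ N + 1 → ∀ c : ℝ, |c| ≤ ‖x - y‖ →
      c * inner ℝ (x.now - y.now) (φ z) ≤ C * ‖x - y‖ ^ 2 := by
    intro z hz c hc
    refine (le_abs_self _).trans ?_
    rw [abs_mul]
    calc |c| * |inner ℝ (x.now - y.now) (φ z)| ≤ ‖x - y‖ * (‖x - y‖ * C) := by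
          refine mul_le_mul hc ((abs_real_inner_le_norm _ _).trans ?_) (abs_nonneg _)
            (norm_nonneg _)
          exact mul_le_mul hnow (hφ z hz) (norm_nonneg _) (norm_nonneg _)
      _ = C * ‖x - y‖ ^ 2 := by ring
  have hLn : 0 ≤ L * ‖x - y‖ ^ 2 := by positivity
  have hχ := abs_cutoff_sub_le N x y
  rcases le_total ‖x‖ (N + 1) with hx | hx <;> rcases le_total ‖y‖ (N + 1) with hy | hy
  · have h1 : cutoff N x • φ x - cutoff N y • φ y =
        cutoff N x • (φ x - φ y) + (cutoff N x - cutoff N y) • φ y := by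
      rw [smul_sub, sub_smul]; abel
    rw [h1, inner_add_right, inner_smul_right, inner_smul_right]
    have h2 : cutoff N x * inner ℝ (x.now - y.now) (φ x - φ y) ≤ L * ‖x - y‖ ^ 2 := by
      calc _ ≤ cutoff N x * (L * ‖x - y‖ ^ 2) :=
            mul_le_mul_of_nonneg_left (hosl x y hx hy) (cutoff_nonneg _ _)
        _ ≤ 1 * (L * ‖x - y‖ ^ 2) := mul_le_mul_of_nonneg_right (cutoff_le_one _ _) hLn
        _ = _ := one_mul _
    linarith [hmul y hy _ hχ]
  · rw [cutoff_of_ge hy] at hχ ⊢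
    rw [sub_zero] at hχ
    rw [zero_smul, sub_zero, inner_smul_right]
    linarith [hmul x hx _ hχ]
  · rw [cutoff_of_ge hx] at hχ ⊢
    rw [zero_sub] at hχ
    rw [zero_smul, zero_sub, ← neg_smul, inner_smul_right]
    linarith [hmul y hy _ hχ]
  · rw [cutoff_of_ge hx, cutoff_of_ge hy]
    simp only [zero_smul, sub_zero, inner_zero_right]
    positivity

/-- The right-hand side along given inputs, cut off outside a ball of histories and outside the
time interval `[t₀, T]`. -/
noncomputable def truncField (f : ℝ → Vec l → Hist r n → Vec m → Vec k → Vec n) (t₀ T N : ℝ)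
    (v : ℝ → Vec k) (u : ℝ → Vec m) (d : ℝ → Vec l) (t : ℝ) (x : Hist r n) : Vec n :=
  (Icc t₀ T).indicator (fun t => cutoff N x • f t (d t) x (u t) (v t)) t

theorem truncField_of_mem {f : ℝ → Vec l → Hist r n → Vec m → Vec k → Vec n} {t₀ T N : ℝ}
    {v : ℝ → Vec k} {u : ℝ → Vec m} {d : ℝ → Vec l} {t : ℝ} (ht : t ∈ Icc t₀ T) (x : Hist r n) :
    truncField f t₀ T N v u d t x = cutoff N x • f t (d t) x (u t) (v t) :=
  indicator_of_mem ht _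

theorem truncField_of_le {f : ℝ → Vec l → Hist r n → Vec m → Vec k → Vec n} {t₀ T N : ℝ}
    {v : ℝ → Vec k} {u : ℝ → Vec m} {d : ℝ → Vec l} {t : ℝ} (ht : t ∈ Icc t₀ T) {x : Hist r n}
    (hx : ‖x‖ ≤ N) : truncField f t₀ T N v u d t x = f t (d t) x (u t) (v t) := by
  rw [truncField_of_mem ht, cutoff_of_le hx, one_smul]

variable {D : Set (Vec l)} {U : Set (Vec m)} {S₁ : Set (Vec k₁)} {S₂ : Set (Vec k)}
  {f : ℝ → Vec l → Hist r n → Vec m → Vec k → Vec n} {H : ℝ → Hist r n → Vec k₁}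
  {v : ℝ → Vec k} {u : ℝ → Vec m} {d : ℝ → Vec l}

/-- The right-hand side is measurable along continuous curves of histories. -/
theorem SystemHyp.aestronglyMeasurable (hsys : SystemHyp D U S₁ S₂ f H) {t₀ : ℝ} (h0 : 0 ≤ t₀)
    (T : ℝ) (hv : IsInput S₂ v) (hu : IsInput U u) (hd : IsInput D d) {ξ : ℝ → Hist r n}
    (hξ : Continuous ξ) :
    AEStronglyMeasurable (fun t => f t (d t) (ξ t) (u t) (v t)) (volume.restrict (Icc t₀ T)) := by
  obtain ⟨A, -, hA, hcont⟩ := hsys.f_time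
  have hAc : A.Countable := by
    rcases hA with hA | ⟨s, -, -, -, rfl⟩
    · exact hA.countable
    · exact countable_range s
  obtain ⟨d₀, hd₀⟩ := hsys.D_nonempty
  obtain ⟨s₀, hs₀, hs₀A⟩ : ∃ s₀ : ℝ, s₀ ∈ Ici 0 ∧ s₀ ∉ A := by
    by_contra! hcon
    have h1 : (Ici (0 : ℝ)).Countable := hAc.mono hcon
    have h2 := h1.measure_zero volume
    simp at h2
  set S : Set (ℝ × Hist r n × Vec m × Vec k × Vec l) := (Ici 0 \ A) ×ˢ univ ×ˢ U ×ˢ S₂ ×ˢ D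
  have hsub : Icc t₀ T ⊆ Ici 0 := fun t ht => h0.trans ht.1
  have hres : volume.restrict (Icc t₀ T) ≤ volume.restrict (Ici (0 : ℝ)) :=
    Measure.restrict_mono hsub le_rfl
  let p : ℝ → ℝ × Hist r n × Vec m × Vec k × Vec l := fun t => (t, ξ t, u t, v t, d t)
  have hp : AEStronglyMeasurable p (volume.restrict (Icc t₀ T)) :=
    continuous_id.aestronglyMeasurable.prodMk (hξ.aestronglyMeasurable.prodMk
      ((hu.meas.mono_measure hres).aestronglyMeasurable.prodMk
        ((hv.meas.mono_measure hres).aestronglyMeasurable.prodMk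
          (hd.meas.mono_measure hres).aestronglyMeasurable)))
  classical
  -- Times in A are null, and there and outside [t₀, T] the curve is replaced by a fixed admissible
  -- point. Thus q takes all its values in the set where f is jointly continuous, and f composed
  -- with q is measurable.
  let q : ℝ → ℝ × Hist r n × Vec m × Vec k × Vec l :=
    fun t => if t ∈ Icc t₀ T \ A then p t else (s₀, 0, 0, 0, d₀)
  have hqS : ∀ t, q t ∈ S := by
    intro t
    by_cases ht : t ∈ Icc t₀ T \ A
    · simp only [q, if_pos ht]
      have h0t := hsub ht.1
      exact ⟨⟨h0t, ht.2⟩, trivial, hu.mem t h0t, hv.mem t h0t, hd.mem t h0t⟩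
    · simp only [q, if_neg ht]
      exact ⟨⟨hs₀, hs₀A⟩, trivial, hsys.zero_mem_U, hsys.zero_mem_S₂, hd₀⟩
  have hAe : ∀ᵐ t ∂volume.restrict (Icc t₀ T), t ∈ Icc t₀ T \ A := by
    have h1 : ∀ᵐ t ∂volume.restrict (Icc t₀ T), t ∉ A :=
      ae_restrict_of_ae (measure_eq_zero_iff_ae_notMem.1 (hAc.measure_zero volume))
    filter_upwards [ae_restrict_mem measurableSet_Icc, h1] with t h2 h3 using ⟨h2, h3⟩
  have hpq : p =ᵐ[volume.restrict (Icc t₀ T)] q := by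
    filter_upwards [hAe] with t ht
    simp only [q, if_pos ht]
  have hq : AEStronglyMeasurable (codRestrict q S hqS) (volume.restrict (Icc t₀ T)) :=
    Topology.IsEmbedding.subtypeVal.aestronglyMeasurable_comp_iff.1 (hp.congr hpq)
  have hg := (continuousOn_iff_continuous_domRestrict.1 hcont).comp_aestronglyMeasurable hq
  refine hg.congr ?_
  filter_upwards [hAe] with t ht
  simp [q, p, ht.1.1, ht.1.2, ht.2]

/-- On [t₀, T] the inputs are bounded, so times, inputs and truncated histories range over one
bounded set; the growth condition provides C there and the one-sided condition provides L. -/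
theorem SystemHyp.boundedField_trunc (hsys : SystemHyp D U S₁ S₂ f H) {t₀ : ℝ} (h0 : 0 ≤ t₀)
    (T : ℝ) (N : ℝ) (hv : IsInput S₂ v) (hu : IsInput U u) (hd : IsInput D d) :
    ∃ C L, BoundedField (truncField f t₀ T N v u d) C L := by
  obtain ⟨β, a, hβ, ha, hgrow⟩ := hsys.f_growth
  obtain ⟨B, hB0, hB⟩ := exists_bound_Icc hβ.cont T
  obtain ⟨Cu, hCu⟩ := hu.bdd T
  obtain ⟨Cv, hCv⟩ := hv.bdd T
  obtain ⟨L, hL, hosl⟩ := hsys.f_oneSidedLip (Icc 0 T) Icc_subset_Ici_self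
    (Metric.isBounded_Icc 0 T)
    (Metric.closedBall 0 (N + 1) ×ˢ (U ∩ Metric.closedBall 0 Cu) ×ˢ
      (S₂ ∩ Metric.closedBall 0 Cv))
    (prod_mono (subset_univ _) (prod_mono inter_subset_left inter_subset_left))
    (Metric.isBounded_closedBall.prod ((Metric.isBounded_closedBall.subset inter_subset_right).prod
      (Metric.isBounded_closedBall.subset inter_subset_right)))
  have hmem : ∀ t ∈ Icc t₀ T, t ∈ Icc 0 T := fun t ht => ⟨h0.trans ht.1, ht.2⟩
  have hmono : ∀ {c c' : ℝ} {t : ℝ}, t ∈ Icc t₀ T → 0 ≤ c → c ≤ c' → a (β t * c) ≤ a (B * c') := by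
    intro c c' t ht hc hcc
    have hβt := (hβ.pos t (hmem t ht).1).le
    refine ha.mono.monotoneOn (mem_Ici.2 (by positivity))
      (mem_Ici.2 (mul_nonneg hB0 (hc.trans hcc))) ?_
    exact mul_le_mul (hB t (hmem t ht)) hcc hc hB0
  -- The maximum keeps C nonnegative also when the time interval is empty or N + 1 is negative,
  -- where the other term carries no sign information.
  set C := max 0 (a (B * (N + 1)) + a (B * Cu) + a (B * Cv))
  have hC : 0 ≤ C := le_max_left _ _
  have hφ : ∀ t ∈ Icc t₀ T, ∀ x : Hist r n, ‖x‖ ≤ N + 1 → ‖f t (d t) x (u t) (v t)‖ ≤ C := by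
    intro t ht x hx
    have h0t := (hmem t ht).1
    refine (hgrow t h0t _ (hd.mem t h0t) x _ (hu.mem t h0t) _ (hv.mem t h0t)).trans ?_
    refine le_trans ?_ (le_max_right _ _)
    exact add_le_add (add_le_add (hmono ht (norm_nonneg _) hx)
      (hmono ht (norm_nonneg _) (hCu t (hmem t ht)))) (hmono ht (norm_nonneg _) (hCv t (hmem t ht)))
  refine ⟨C, L + C, ?_, ?_, by positivity, ?_, ?_⟩
  · intro ξ hξ
    have : (fun t => truncField f t₀ T N v u d t (ξ t)) = (Icc t₀ T).indicator
        (fun t => cutoff N (ξ t) • f t (d t) (ξ t) (u t) (v t)) := by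
      ext1 t
      by_cases ht : t ∈ Icc t₀ T <;> simp [truncField, ht]
    rw [this, aestronglyMeasurable_indicator_iff measurableSet_Icc]
    exact ((continuous_cutoff N).comp hξ).aestronglyMeasurable.smul
      (hsys.aestronglyMeasurable h0 T hv hu hd hξ)
  · intro t x
    by_cases ht : t ∈ Icc t₀ T
    · rw [truncField_of_mem ht]
      exact cutoff_smul_bound hC (hφ t ht) x
    · simpa [truncField, ht] using hC
  · intro t x y
    by_cases ht : t ∈ Icc t₀ T
    · rw [truncField_of_mem ht, truncField_of_mem ht]
      have h0t := (hmem t ht).1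
      refine inner_cutoff_smul_sub_le hC hL (hφ t ht) (fun x y hx hy => ?_) x y
      have hu' : u t ∈ U ∩ Metric.closedBall 0 Cu :=
        ⟨hu.mem t h0t, mem_closedBall_zero_iff.2 (hCu t (hmem t ht))⟩
      have hv' : v t ∈ S₂ ∩ Metric.closedBall 0 Cv :=
        ⟨hv.mem t h0t, mem_closedBall_zero_iff.2 (hCv t (hmem t ht))⟩
      exact hosl t (hmem t ht) x y (u t) (v t) ⟨mem_closedBall_zero_iff.2 hx, hu', hv'⟩
        ⟨mem_closedBall_zero_iff.2 hy, hu', hv'⟩ (d t) (hd.mem t h0t)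
    · simp only [truncField, indicator_of_notMem ht, sub_self, inner_zero_right]
      positivity
  · intro t
    by_cases ht : t ∈ Icc t₀ T
    · have h0t := (hmem t ht).1
      have : Continuous fun x => f t (d t) x (u t) (v t) :=
        (hsys.f_cont t h0t).comp_continuous (f := fun x => (x, u t, v t, d t)) (by fun_prop)
          fun x => ⟨trivial, hu.mem t h0t, hv.mem t h0t, hd.mem t h0t⟩
      have heq : truncField f t₀ T N v u d t =
          fun x => cutoff N x • f t (d t) x (u t) (v t) := funext (truncField_of_mem ht)
      rw [heq]
      exact (continuous_cutoff N).smul this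
    · have heq : truncField f t₀ T N v u d t = fun _ => 0 :=
        funext fun x => indicator_of_notMem ht _
      rw [heq]
      exact continuous_const

/-! ### Lipschitz histories are dense -/

theorem Hist.exists_lipschitz_near (x : Hist r n) {e : ℝ} (he : 0 < e) :
    ∃ (y : Hist r n) (K : ℝ≥0), LipschitzWith K y.ext ∧ ‖y - x‖ ≤ e := by
  obtain ⟨δ, hδ, hx⟩ := Metric.uniformContinuous_iff.1 x.uniformContinuous_ext e he
  set h := δ / 2 with hh
  have hh0 : 0 < h := by positivity
  have hint : ∀ a b, IntervalIntegrable x.ext volume a b := fun a b =>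
    x.continuous_ext.intervalIntegrable a b
  let P : ℝ → Vec n := fun t => ∫ s in (0 : ℝ)..t, x.ext s
  have hP : LipschitzWith ‖x‖.toNNReal P := LipschitzWith.of_dist_le_mul fun t s => by
    rw [dist_eq_norm, Real.dist_eq, Real.coe_toNNReal _ (norm_nonneg _),
      intervalIntegral.integral_interval_sub_left (hint _ _) (hint _ _)]
    exact intervalIntegral.norm_integral_le_of_norm_le_const fun τ _ => x.norm_ext_le τ
  have hP' : LipschitzWith ‖x‖.toNNReal fun t => P (t + h) := fun a b => by
    simpa using hP (a + h) (b + h)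
  -- The moving average over [t, t + h] is Lipschitz because x is bounded, and it is e-close to x
  -- because h is smaller than δ.
  let Y : ℝ → Vec n := fun t => h⁻¹ • (P (t + h) - P t)
  have hY : LipschitzWith (‖h⁻¹‖₊ * (‖x‖.toNNReal + ‖x‖.toNNReal)) Y :=
    (lipschitzWith_smul h⁻¹).comp (hP'.sub hP)
  refine ⟨⟨fun θ => Y θ, hY.continuous.comp continuous_subtype_val⟩, _,
    ((hY.comp (LipschitzWith.subtype_val _)).comp (LipschitzWith.projIcc (neg_le_zero r))), ?_⟩
  refine (ContinuousMap.norm_le _ he.le).2 fun θ => ?_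
  change ‖Y θ - x θ‖ ≤ e
  have h1 : Y θ - x θ = h⁻¹ • ∫ s in (θ : ℝ)..(θ + h), (x.ext s - x.ext θ) := by
    rw [intervalIntegral.integral_sub (hint _ _) intervalIntegrable_const,
      intervalIntegral.integral_const, add_sub_cancel_left, smul_sub, smul_smul,
      inv_mul_cancel₀ hh0.ne', one_smul, Hist.ext_apply]
    simp only [Y, P]
    rw [intervalIntegral.integral_interval_sub_left (hint _ _) (hint _ _)]
  rw [h1, norm_smul, norm_inv, Real.norm_of_nonneg hh0.le, inv_mul_le_iff₀ hh0, mul_comm]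
  have := intervalIntegral.norm_integral_le_of_norm_le_const (a := (θ : ℝ)) (b := θ + h) (C := e)
    (f := fun s => x.ext s - x.ext θ) fun s hs => ?_
  · rwa [add_sub_cancel_left, abs_of_pos hh0] at this
  · rw [uIoc_of_le (by linarith)] at hs
    rw [← dist_eq_norm]
    refine (hx ?_).le
    rw [Real.dist_eq, abs_of_nonneg (by linarith [hs.1])]
    linarith [hs.2]

end RFDE

/-! ### Evolution of V along solutions -/

namespace RFDE

variable {r : ℝ≥0} {n l m k k₁ : ℕ}

/-! ### Functionals along trajectories -/

theorem AlmostLipschitz.continuous {V : ℝ → Hist r n → ℝ} (hV : AlmostLipschitz V) {t : ℝ}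
    (ht : 0 ≤ t) : Continuous (V t) :=
  hV.cont.comp_continuous (f := fun x => (t, x)) (by fun_prop) fun _ => ⟨ht, trivial⟩

theorem lipschitzWith_history_ext {x : C(ℝ, Vec n)} {K : ℝ≥0} {t₀ T t : ℝ}
    (hx : LipschitzOnWith K x (Icc (t₀ - r) T)) (ht : t ∈ Icc t₀ T) :
    LipschitzWith K (history r x t).ext := by
  have hY : LipschitzWith K fun θ : Icc (-(r : ℝ)) 0 => x (t + θ) := by
    refine LipschitzWith.of_dist_le_mul fun a b => ?_
    have ha := a.2
    have hb := b.2
    refine (hx.dist_le_mul (t + a) ⟨by linarith [ha.1, ht.1], by linarith [ha.2, ht.2]⟩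
      (t + b) ⟨by linarith [hb.1, ht.1], by linarith [hb.2, ht.2]⟩).trans_eq ?_
    rw [dist_add_left, Subtype.dist_eq]
  have := hY.comp (LipschitzWith.projIcc (neg_le_zero r))
  rwa [mul_one] at this

theorem Hist.speed_le_of_lipschitz {x : Hist r n} {K : ℝ≥0} (hx : LipschitzWith K x.ext) :
    x.speed ≤ K := by
  refine essSup_le_of_ae_le _ (.of_forall fun τ => ?_)
  simp only
  rw [← ofReal_norm, ← ENNReal.ofReal_coe_nnreal]
  exact ENNReal.ofReal_le_ofReal (norm_deriv_le_of_lipschitz hx)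

/-- Along a Lipschitz trajectory, an almost Lipschitz functional is Lipschitz. -/
theorem AlmostLipschitz.lipschitzOn {V : ℝ → Hist r n → ℝ} (hV : AlmostLipschitz V) {t₀ T : ℝ}
    (h0 : 0 ≤ t₀) (hT : t₀ ≤ T) {x : C(ℝ, Vec n)} {K : ℝ≥0}
    (hx : LipschitzOnWith K x (Icc (t₀ - r) T)) :
    ∃ C : ℝ≥0, LipschitzOnWith C (fun t => V t (history r x t)) (Icc t₀ T) := by
  obtain ⟨M, P, G, -, hM0, -, hP0, hGm, hG1, hlip⟩ := hV.almostLip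
  have hWc : ContinuousOn (fun t => V t (history r x t)) (Icc t₀ T) :=
    hV.cont.comp (f := fun t => (t, history r x t))
      (continuous_id.prodMk (continuous_history x)).continuousOn
      fun t ht => ⟨h0.trans ht.1, trivial⟩
  obtain ⟨S, hS⟩ := isCompact_Icc.exists_bound_of_continuousOn hWc
  obtain ⟨R₀, hR₀⟩ := isCompact_Icc.exists_bound_of_continuousOn
    (continuous_history (r := r) x).continuousOn (s := Icc t₀ T)
  set R := max T R₀
  have hTR : T ≤ R := le_max_left _ _
  have hR : 0 ≤ R := (h0.trans hT).trans hTR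
  have hxR : ∀ t ∈ Icc t₀ T, ‖history r x t‖ ≤ R := fun t ht =>
    (hR₀ t ht).trans (le_max_right _ _)
  have hRK : 0 ≤ R + K := by positivity
  obtain ⟨hl1, hl2⟩ := hlip R hR
  have hG := hG1 (R + K) hRK
  set h₀ := 1 / G (R + K)
  have hh₀ : 0 < h₀ := by positivity
  set C₁ := M R * K + P R * (1 + K)
  have hC₁ : 0 ≤ C₁ := by
    have := hM0 R hR
    have := hP0 R hR
    positivity
  have hS0 : 0 ≤ S := (norm_nonneg _).trans (hS t₀ ⟨le_rfl, hT⟩)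
  -- Increments up to h₀ use the two almost Lipschitz properties; h₀ is admissible for every history
  -- on the trajectory because all speeds are at most K and G is non-decreasing. For longer
  -- increments the bound |V| ≤ S gives 2S ≤ (2S / h₀)(t - s).
  have hstep : ∀ s ∈ Icc t₀ T, ∀ t ∈ Icc t₀ T, s ≤ t →
      |V t (history r x t) - V s (history r x s)| ≤ max C₁ (2 * S / h₀) * (t - s) := by
    intro s hs t ht hst
    rcases le_total (t - s) h₀ with h | h
    · have hext := lipschitzWith_history_ext hx hs
      have hsp := Hist.speed_le_of_lipschitz hext
      have hsp' : (history r x s).speed.toReal ≤ K := ENNReal.toReal_mono ENNReal.coe_ne_top hsp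
      have h1 : |V t (history r x t) - V t (history r x s)| ≤ M R * (K * (t - s)) := by
        refine (hl1 _ _ (hxR s hs) (hxR t ht) t ⟨h0.trans ht.1, ht.2.trans hTR⟩).trans ?_
        refine mul_le_mul_of_nonneg_left ?_ (hM0 R hR)
        refine norm_history_sub_le (mul_nonneg K.2 (sub_nonneg.2 hst)) fun θ hθ => ?_
        rw [← dist_eq_norm]
        refine (hx.dist_le_mul _ ⟨?_, ?_⟩ _ ⟨?_, ?_⟩).trans_eq ?_
        · linarith [hθ.1, ht.1]
        · linarith [hθ.2, ht.2]
        · linarith [hθ.1, hs.1]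
        · linarith [hθ.2, hs.2]
        · rw [Real.dist_eq, add_sub_add_right_eq_sub, abs_of_nonneg (sub_nonneg.2 hst)]
      have h2 : |V t (history r x s) - V s (history r x s)| ≤ (t - s) * P R * (1 + K) := by
        have := hl2 (history r x s) (hxR s hs)
          (hext.lipschitzOnWith.absolutelyContinuousOnInterval)
          (ne_top_of_le_ne_top ENNReal.coe_ne_top hsp) s ⟨h0.trans hs.1, hs.2.trans hTR⟩
          (t - s) (sub_nonneg.2 hst) (h.trans ?_)
        · rw [add_sub_cancel] at this
          refine this.trans ?_
          have := hP0 R hR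
          have := sub_nonneg.2 hst
          gcongr
        · have hle : G (R + (history r x s).speed.toReal) ≤ G (R + K) :=
            hGm (mem_Ici.2 (by positivity)) hRK (by linarith)
          have := hG1 (R + (history r x s).speed.toReal) (by positivity)
          exact one_div_le_one_div_of_le (by linarith) hle
      calc _ = |(V t (history r x t) - V t (history r x s))
            + (V t (history r x s) - V s (history r x s))| := by rw [sub_add_sub_cancel]
        _ ≤ C₁ * (t - s) := by
            refine (abs_add_le _ _).trans ?_
            simp only [C₁]
            linarith
        _ ≤ _ := mul_le_mul_of_nonneg_right (le_max_left _ _) (sub_nonneg.2 hst)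
    · have h1 : |V t (history r x t) - V s (history r x s)| ≤ 2 * S := by
        refine (abs_sub _ _).trans ?_
        have := hS s hs
        have := hS t ht
        simp only [Real.norm_eq_abs] at *
        linarith
      refine h1.trans ?_
      calc 2 * S = 2 * S / h₀ * h₀ := by field_simp
        _ ≤ max C₁ (2 * S / h₀) * (t - s) :=
          mul_le_mul (le_max_right _ _) h hh₀.le (hC₁.trans (le_max_left _ _))
  refine ⟨(max C₁ (2 * S / h₀)).toNNReal, LipschitzOnWith.of_dist_le_mul fun s hs t ht => ?_⟩
  rw [Real.coe_toNNReal _ (hC₁.trans (le_max_left _ _)), Real.dist_eq, Real.dist_eq]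
  rcases le_total s t with h | h
  · rw [abs_sub_comm, abs_sub_comm s, abs_of_nonneg (sub_nonneg.2 h)]
    exact hstep s hs t ht h
  · rw [abs_of_nonneg (sub_nonneg.2 h)]
    exact hstep t ht s hs h

/-- The derivative of a functional along a trajectory is bounded by its generalized derivative. -/
theorem le_genDeriv {V : ℝ → Hist r n → ℝ} {x : C(ℝ, Vec n)} {t W' : ℝ} {w : Vec n}
    (hx : HasDerivAt x w t) (hW : HasDerivAt (fun s => V s (history r x s)) W' t) :
    (W' : EReal) ≤ genDeriv V t (history r x t) w := by
  set ξ := history r x t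
  -- This perturbation makes E_h + h y the true history at time t + h. It vanishes for θ ≤ -h, and
  -- on the rest it is the error of the linear approximation of x at t divided by h, which tends to
  -- 0. The slopes of V along x thus occur among the quotients defining `genDeriv`.
  let y : ℝ → Hist r n := fun h => h⁻¹ • (history r x (t + h) - ξ.extrapolate h w)
  have hy : Tendsto y (𝓝[>] 0) (𝓝 0) := by
    rw [Metric.tendsto_nhds]
    intro e he
    have h1 := (hasDerivAt_iff_isLittleO.1 hx).def (show 0 < e / 2 by positivity)
    obtain ⟨δ, hδ, hball⟩ := Metric.eventually_nhds_iff.1 h1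
    filter_upwards [Ioo_mem_nhdsGT hδ] with h hh
    rw [dist_zero_right]
    refine lt_of_le_of_lt ?_ (half_lt_self he)
    rw [norm_smul, norm_inv, Real.norm_of_nonneg hh.1.le, inv_mul_le_iff₀ hh.1]
    refine (ContinuousMap.norm_le _ (mul_nonneg hh.1.le (by positivity))).2 fun θ => ?_
    have hθ := θ.2
    change ‖x (t + h + θ) - (if (θ : ℝ) ≤ -h then ξ.ext (θ + h) else ξ.now + ((θ : ℝ) + h) • w)‖ ≤ _
    split_ifs with hc
    · have : ξ.ext (θ + h) = x (t + h + θ) := by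
        have hm : (θ : ℝ) + h ∈ Icc (-(r : ℝ)) 0 := ⟨by linarith [hθ.1, hh.1], by linarith⟩
        rw [Hist.ext, IccExtend_of_mem _ _ hm, history_apply]
        congr 1
        ring
      rw [this, sub_self, norm_zero]
      exact mul_nonneg hh.1.le (by positivity)
    · have hpos : 0 ≤ (θ : ℝ) + h := by linarith
      have hle : (θ : ℝ) + h ≤ h := by linarith [hθ.2]
      have := hball (y := t + h + θ) (by
        rw [Real.dist_eq, show t + h + θ - t = θ + h by ring, abs_of_nonneg hpos]
        linarith [hh.2])
      rw [show t + h + θ - t = θ + h by ring, Real.norm_of_nonneg hpos] at this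
      rw [history_now, ← sub_sub]
      refine this.trans ?_
      rw [mul_comm]
      gcongr
  let q : ℝ × Hist r n → EReal := fun p =>
    (((V (t + p.1) (ξ.extrapolate p.1 w + p.1 • p.2) - V t ξ) / p.1 : ℝ) : EReal)
  have hp : Tendsto (fun h : ℝ => (h, y h)) (𝓝[>] 0) (𝓝[>] 0 ×ˢ 𝓝 0) := tendsto_id.prodMk hy
  have hq : Tendsto (q ∘ fun h => (h, y h)) (𝓝[>] 0) (𝓝 (W' : EReal)) := by
    have hs : Tendsto (fun h => h⁻¹ • (V (t + h) (history r x (t + h)) - V t ξ)) (𝓝[>] 0)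
        (𝓝 W') := hW.tendsto_slope_zero_right
    refine (continuous_coe_real_ereal.tendsto _).comp hs |>.congr' ?_
    filter_upwards [self_mem_nhdsWithin] with h hh
    have hh0 : h ≠ 0 := (mem_Ioi.1 hh).ne'
    simp only [Function.comp, q, y, smul_smul, mul_inv_cancel₀ hh0, one_smul, add_sub_cancel,
      smul_eq_mul, div_eq_inv_mul]
  rw [← hq.limsup_eq]
  exact limsup_le_limsup_of_le (u := q) hp

/-! ### The dissipation estimate -/

variable {D : Set (Vec l)} {U : Set (Vec m)} {S₁ : Set (Vec k₁)} {S₂ : Set (Vec k)}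
  {f : ℝ → Vec l → Hist r n → Vec m → Vec k → Vec n} {H : ℝ → Hist r n → Vec k₁}
  {v : ℝ → Vec k} {u : ℝ → Vec m} {d : ℝ → Vec l}

theorem IsInput.bddAbove {S : Set (Vec k)} {w : ℝ → Vec k} (hw : IsInput S w) {γ δ : ℝ → ℝ}
    (hγ : ClassN γ) (hδ : ClassKPlus δ) {t₀ : ℝ} (h0 : 0 ≤ t₀) (T : ℝ) :
    BddAbove (range fun τ : Icc t₀ T => γ (δ τ * ‖w τ‖)) := by
  obtain ⟨B, hB0, hB⟩ := exists_bound_Icc hδ.cont T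
  obtain ⟨C, hC⟩ := hw.bdd T
  refine ⟨γ (B * C), ?_⟩
  rintro _ ⟨⟨τ, hτ⟩, rfl⟩
  have hm : τ ∈ Icc 0 T := ⟨h0.trans hτ.1, hτ.2⟩
  have hδτ := (hδ.pos τ hm.1).le
  have hCτ := hC τ hm
  exact hγ.mono (mem_Ici.2 (by positivity)) (mem_Ici.2 (mul_nonneg hB0
    ((norm_nonneg _).trans hCτ))) (mul_le_mul (hB τ hm) hCτ (norm_nonneg _) hB0)

/-- The hypotheses on the functional `V` along the system. -/
structure Dissipative (D : Set (Vec l)) (U : Set (Vec m)) (S₂ : Set (Vec k))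
    (f : ℝ → Vec l → Hist r n → Vec m → Vec k → Vec n) (V : ℝ → Hist r n → ℝ)
    (ζ ζᵤ δ δᵤ ρ : ℝ → ℝ) : Prop where
  almostLip : AlmostLipschitz V
  classN : ClassN ζ
  classN_u : ClassN ζᵤ
  weight : ClassKPlus δ
  weight_u : ClassKPlus δᵤ
  rate : ContPosDef ρ
  decay : ∀ t, 0 ≤ t → ∀ x, ∀ u ∈ U, ∀ v ∈ S₂, ∀ d ∈ D,
    max (ζ (δ t * ‖v‖)) (ζᵤ (δᵤ t * ‖u‖)) ≤ V t x →
      genDeriv V t x (f t d x u v) ≤ ((-ρ (V t x) : ℝ) : EReal)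

namespace Dissipative

variable {V : ℝ → Hist r n → ℝ} {ζ ζᵤ δ δᵤ ρ : ℝ → ℝ}

/-- Lipschitz regularity on the whole interval [t₀ - r, T] makes V Lipschitz along x. Above the
supremum of the gains, the decay condition then yields the scalar inequality required by
`le_max_decayFlow`. -/
theorem le_of_lipschitz (hD : Dissipative D U S₂ f V ζ ζᵤ δ δᵤ ρ) {t₀ T : ℝ} (h0 : 0 ≤ t₀)
    (hT : t₀ ≤ T) (hv : IsInput S₂ v) (hu : IsInput U u) (hd : IsInput D d)
    {x : C(ℝ, Vec n)} {K : ℝ≥0} (hxK : LipschitzOnWith K x (Icc (t₀ - r) T))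
    (hx : SolvesOn (fun t ξ => f t (d t) ξ (u t) (v t)) t₀ T x) :
    V T (history r x T) ≤ max (decayFlow hD.rate (V t₀ (history r x t₀)) (T - t₀))
      (max (⨆ τ : Icc t₀ T, ζ (δ τ * ‖v τ‖)) (⨆ τ : Icc t₀ T, ζᵤ (δᵤ τ * ‖u τ‖))) := by
  obtain ⟨C, hC⟩ := hD.almostLip.lipschitzOn h0 hT hxK
  refine le_max_decayFlow hD.rate hT ?_ hC ?_
  · refine le_max_of_le_left (Real.iSup_nonneg fun τ => hD.classN.nonneg ?_)
    exact mul_nonneg (hD.weight.pos τ (h0.trans τ.2.1)).le (norm_nonneg _)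
  · filter_upwards [hx.ode, ae_hasDerivAt_of_lipschitzOn hT hC] with t h1 h2 ht hle
    have h0t := h0.trans ht.1
    have := (le_genDeriv (h1 ht) (h2 ht)).trans
      (hD.decay t h0t _ _ (hu.mem t h0t) _ (hv.mem t h0t) _ (hd.mem t h0t) (le_trans ?_ hle))
    · exact_mod_cast this
    · exact max_le_max
        (le_ciSup (hv.bddAbove hD.classN hD.weight h0 T) ⟨t, ht⟩)
        (le_ciSup (hu.bddAbove hD.classN_u hD.weight_u h0 T) ⟨t, ht⟩)

/-- The dissipation estimate along arbitrary solutions. -/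
theorem le (hD : Dissipative D U S₂ f V ζ ζᵤ δ δᵤ ρ) (hsys : SystemHyp D U S₁ S₂ f H) {t₀ T : ℝ}
    (h0 : 0 ≤ t₀) (hT : t₀ ≤ T) (hv : IsInput S₂ v) (hu : IsInput U u) (hd : IsInput D d)
    {x : C(ℝ, Vec n)} (hx : SolvesOn (fun t ξ => f t (d t) ξ (u t) (v t)) t₀ T x) :
    V T (history r x T) ≤ max (decayFlow hD.rate (V t₀ (history r x t₀)) (T - t₀))
      (max (⨆ τ : Icc t₀ T, ζ (δ τ * ‖v τ‖)) (⨆ τ : Icc t₀ T, ζᵤ (δᵤ τ * ‖u τ‖))) := by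
  obtain ⟨N, hN⟩ := isCompact_Icc.exists_bound_of_continuousOn
    (continuous_history (r := r) x).continuousOn (s := Icc t₀ T)
  -- The histories of x have norm at most N; the extra unit leaves room for the approximating
  -- solutions, which therefore eventually solve the original equation.
  obtain ⟨C, L, hF⟩ := hsys.boundedField_trunc h0 T (N + 1) hv hu hd
  have hFf : ∀ t ∈ Icc t₀ T, ∀ ξ : Hist r n, ‖ξ‖ ≤ N + 1 →
      truncField f t₀ T (N + 1) v u d t ξ = f t (d t) ξ (u t) (v t) := fun t ht ξ hξ =>
    truncField_of_le ht hξ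
  set F := truncField f t₀ T (N + 1) v u d
  have hxF : SolvesOn F t₀ T x := by
    refine ⟨hx.absCont, ?_⟩
    filter_upwards [hx.ode] with t ht htm
    rw [hFf t htm _ ((hN t htm).trans (by linarith))]
    exact ht htm
  let ε : ℕ → ℝ := fun j => 1 / (j + 1)
  have hε : ∀ j, 0 < ε j := fun j => Nat.one_div_pos_of_nat
  have hε0 : Tendsto ε atTop (𝓝 0) := tendsto_one_div_add_atTop_nhds_zero_nat
  choose y K hyK hy using fun j => (history r x t₀).exists_lipschitz_near (hε j)
  choose z hzinit hzint using fun j => hF.exists_solution hT (y j)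
  have hz : ∀ j, SolvesOn F t₀ T (z j) := fun j => hF.solvesOn_of_integral hT (hzint j)
  have hz0 : ∀ j, history r (z j) t₀ = y j := fun j => by
    ext1 θ
    rw [history_apply, hzinit j _ (by linarith [θ.2.2]), add_sub_cancel_left, Hist.ext_apply]
  have hdist : ∀ j, ∀ t ∈ Icc t₀ T, ‖history r (z j) t - history r x t‖ ≤
      ε j * Real.exp (2 * L * (T - t₀)) := by
    intro j t ht
    refine (hF.norm_history_sub_le_exp (hz j) hxF ht).trans ?_
    rw [hz0]
    have := hF.nonneg
    have := ht.2
    gcongr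
    exact hy j
  have hlim0 : Tendsto (fun j => ε j * Real.exp (2 * L * (T - t₀))) atTop (𝓝 0) := by
    simpa using hε0.mul_const (Real.exp (2 * L * (T - t₀)))
  have hlim : ∀ t ∈ Icc t₀ T, Tendsto (fun j => history r (z j) t) atTop (𝓝 (history r x t)) :=
    fun t ht => tendsto_iff_norm_sub_tendsto_zero.2
      (squeeze_zero (fun _ => norm_nonneg _) (fun j => hdist j t ht) hlim0)
  have hVlim : ∀ t ∈ Icc t₀ T,
      Tendsto (fun j => V t (history r (z j) t)) atTop (𝓝 (V t (history r x t))) := fun t ht =>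
    ((hD.almostLip.continuous (h0.trans ht.1)).tendsto _).comp (hlim t ht)
  have ht₀ : t₀ ∈ Icc t₀ T := ⟨le_rfl, hT⟩
  have hTm : T ∈ Icc t₀ T := ⟨hT, le_rfl⟩
  have hflow : Tendsto (fun j => decayFlow hD.rate (V t₀ (history r (z j) t₀)) (T - t₀)) atTop
      (𝓝 (decayFlow hD.rate (V t₀ (history r x t₀)) (T - t₀))) := by
    have hc := ((classKL_decayFlow hD.rate).classK (T - t₀) (sub_nonneg.2 hT)).cont
    refine (hc _ (hD.almostLip.nonneg t₀ h0 _)).tendsto.comp ?_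
    exact tendsto_nhdsWithin_iff.2 ⟨hVlim t₀ ht₀, .of_forall fun j => hD.almostLip.nonneg t₀ h0 _⟩
  refine le_of_tendsto_of_tendsto (hVlim T hTm) (hflow.max tendsto_const_nhds) ?_
  filter_upwards [hlim0.eventually (Iic_mem_nhds zero_lt_one)] with j hj
  have hzN : ∀ t ∈ Icc t₀ T, ‖history r (z j) t‖ ≤ N + 1 := fun t ht => by
    have h1 := (hdist j t ht).trans hj
    have h2 := hN t ht
    calc _ = ‖(history r (z j) t - history r x t) + history r x t‖ := by rw [sub_add_cancel]
      _ ≤ _ := (norm_add_le _ _).trans (by linarith)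
  refine hD.le_of_lipschitz (K := max (K j) C.toNNReal) h0 hT hv hu hd ?_ ⟨(hz j).absCont, ?_⟩
  -- The approximating trajectory inherits the constant of its initial history before t₀ and the
  -- bound of the field after t₀; the two estimates are joined through t₀.
  · have hleft : LipschitzOnWith (K j) (z j) (Iic t₀) := fun s hs t ht => by
      rw [hzinit j s hs, hzinit j t ht]
      simpa using hyK j (s - t₀) (t - t₀)
    have hright := hF.lipschitzOn_of_integral (hzint j)
    have hone : ∀ s t, s ≤ t → t ∈ Icc (t₀ - r) T →
        dist (z j s) (z j t) ≤ max (K j : ℝ) C.toNNReal * (t - s) := by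
      intro s t hst ht
      have hK1 := le_max_left (K j : ℝ) C.toNNReal
      have hK2 := le_max_right (K j : ℝ) C.toNNReal
      rcases le_total t t₀ with h | h
      · refine (hleft.dist_le_mul s (hst.trans h) t h).trans ?_
        rw [Real.dist_eq, abs_sub_comm, abs_of_nonneg (sub_nonneg.2 hst)]
        exact mul_le_mul_of_nonneg_right hK1 (sub_nonneg.2 hst)
      · rcases le_total s t₀ with h' | h'
        · have e1 := hleft.dist_le_mul s h' t₀ self_mem_Iic
          have e2 := hright.dist_le_mul t₀ ht₀ t ⟨h, ht.2⟩
          rw [Real.dist_eq, abs_sub_comm, abs_of_nonneg (sub_nonneg.2 h')] at e1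
          rw [Real.dist_eq, abs_sub_comm, abs_of_nonneg (sub_nonneg.2 h)] at e2
          have e3 := mul_le_mul_of_nonneg_right hK1 (sub_nonneg.2 h')
          have e4 := mul_le_mul_of_nonneg_right hK2 (sub_nonneg.2 h)
          linarith [dist_triangle (z j s) (z j t₀) (z j t)]
        · refine (hright.dist_le_mul s ⟨h', hst.trans ht.2⟩ t ⟨h, ht.2⟩).trans ?_
          rw [Real.dist_eq, abs_sub_comm, abs_of_nonneg (sub_nonneg.2 hst)]
          exact mul_le_mul_of_nonneg_right hK2 (sub_nonneg.2 hst)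
    refine LipschitzOnWith.of_dist_le_mul fun s hs t ht => ?_
    rw [NNReal.coe_max]
    rcases le_total s t with h | h
    · rw [Real.dist_eq, abs_sub_comm, abs_of_nonneg (sub_nonneg.2 h)]
      exact hone s t h ht
    · rw [dist_comm, Real.dist_eq, abs_of_nonneg (sub_nonneg.2 h)]
      exact hone t s h hs
  · filter_upwards [(hz j).ode] with t ht htm
    have := ht htm
    rwa [hFf t htm _ (hzN t htm)] at this

end Dissipative

end RFDE

/-! ### Output estimate and global existence -/

namespace RFDE

variable {r : ℝ≥0} {n l m k k₁ : ℕ}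

theorem ClassKL.nonneg {σ : ℝ → ℝ → ℝ} (hσ : ClassKL σ) {s t : ℝ} (hs : 0 ≤ s) (ht : 0 ≤ t) :
    0 ≤ σ s t := (hσ.classK t ht).nonneg hs

theorem ClassKL.conj {σ : ℝ → ℝ → ℝ} (hσ : ClassKL σ) {a b : ℝ → ℝ} (ha : ClassK a)
    (hb : ClassK b) : ClassKL fun s t => a (σ (b s) t) := by
  refine ⟨?_, fun t ht => ⟨?_, ?_, ?_⟩, ?_, ?_⟩
  · refine ha.cont.comp (hσ.cont.comp (f := fun p : ℝ × ℝ => (b p.1, p.2)) ?_ ?_) ?_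
    · exact (hb.cont.comp continuousOn_fst fun p hp => hp.1).prodMk continuousOn_snd
    · exact fun p hp => ⟨hb.nonneg hp.1, hp.2⟩
    · exact fun p hp => hσ.nonneg (hb.nonneg hp.1) hp.2
  · exact ha.cont.comp ((hσ.classK t ht).cont.comp hb.cont fun s hs => hb.nonneg hs)
      fun s hs => hσ.nonneg (hb.nonneg hs) ht
  · intro s hs s' hs' h
    exact ha.mono (hσ.nonneg (hb.nonneg hs) ht) (hσ.nonneg (hb.nonneg hs') ht)
      ((hσ.classK t ht).mono (hb.nonneg hs) (hb.nonneg hs') (hb.mono hs hs' h))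
  · simp [hb.zero, (hσ.classK t ht).zero, ha.zero]
  · intro s hs t ht t' ht' h
    exact ha.mono.monotoneOn (hσ.nonneg (hb.nonneg hs) ht') (hσ.nonneg (hb.nonneg hs) ht)
      (hσ.anti _ (hb.nonneg hs) ht ht' h)
  · intro s hs
    have h0 := (ha.cont 0 self_mem_Ici).tendsto
    rw [ha.zero] at h0
    refine h0.comp (tendsto_nhdsWithin_iff.2 ⟨hσ.lim _ (hb.nonneg hs), ?_⟩)
    filter_upwards [eventually_ge_atTop 0] with t ht using hσ.nonneg (hb.nonneg hs) ht

variable {D : Set (Vec l)} {U : Set (Vec m)} {S₁ : Set (Vec k₁)} {S₂ : Set (Vec k)}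
  {f : ℝ → Vec l → Hist r n → Vec m → Vec k → Vec n} {H : ℝ → Hist r n → Vec k₁}
  {v : ℝ → Vec k} {u : ℝ → Vec m} {d : ℝ → Vec l}

theorem IsSolution.solvesOn {t₀ : ℝ} {x₀ : Hist r n} {x : C(ℝ, Vec n)}
    (hx : IsSolution f t₀ x₀ v u d x) {T : ℝ} (hT : t₀ ≤ T) :
    SolvesOn (fun t ξ => f t (d t) ξ (u t) (v t)) t₀ T x :=
  ⟨hx.absCont T hT, hx.ode.mono fun _ h ht => h ht.1⟩

/-! ### The output estimate -/

namespace Dissipative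

variable {V : ℝ → Hist r n → ℝ} {ζ ζᵤ β δ δᵤ ρ a₂ : ℝ → ℝ}

theorem iSup_nonneg (hD : Dissipative D U S₂ f V ζ ζᵤ δ δᵤ ρ) {t₀ : ℝ} (h0 : 0 ≤ t₀) (T : ℝ) :
    0 ≤ ⨆ τ : Icc t₀ T, ζ (δ τ * ‖v τ‖) :=
  Real.iSup_nonneg fun τ => hD.classN.nonneg
    (mul_nonneg (hD.weight.pos τ (h0.trans τ.2.1)).le (norm_nonneg _))

theorem iSup_u_nonneg (hD : Dissipative D U S₂ f V ζ ζᵤ δ δᵤ ρ) {t₀ : ℝ} (h0 : 0 ≤ t₀) (T : ℝ) :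
    0 ≤ ⨆ τ : Icc t₀ T, ζᵤ (δᵤ τ * ‖u τ‖) :=
  Real.iSup_nonneg fun τ => hD.classN_u.nonneg
    (mul_nonneg (hD.weight_u.pos τ (h0.trans τ.2.1)).le (norm_nonneg _))

/-- The dissipation estimate is a maximum of three terms; a₁⁻¹ of whichever is attained is at most
the sum, since all three are nonnegative. Moving a₁⁻¹ inside the suprema uses only that it is an
increasing bijection, so ζ and ζᵤ may be discontinuous. -/
theorem outputEstimate (hD : Dissipative D U S₂ f V ζ ζᵤ δ δᵤ ρ) (hsys : SystemHyp D U S₁ S₂ f H)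
    (ha₂ : ClassKInf a₂) (hβ : ClassKPlus β) (hup : ∀ t, 0 ≤ t → ∀ x, V t x ≤ a₂ (β t * ‖x‖))
    {a₁ : ℝ → ℝ} (ha₁ : ClassKInf a₁) (hlow : ∀ t, 0 ≤ t → ∀ x, a₁ ‖H t x‖ ≤ V t x) :
    OutputEstimate D U S₂ f H (fun s t => invKInf a₁ (decayFlow hD.rate (a₂ s) t)) β
      (fun s => invKInf a₁ (ζ s)) δ (fun s => invKInf a₁ (ζᵤ s)) δᵤ := by
  intro t₀ h0 x₀ v u d hv hu hd x hx t ht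
  have h0t := h0.trans ht
  have htt := sub_nonneg.2 ht
  have : Nonempty (Icc t₀ t) := ⟨⟨t₀, le_rfl, ht⟩⟩
  have hle := hD.le hsys h0 ht hv hu hd (hx.solvesOn ht)
  rw [hx.init] at hle
  have hkl := classKL_decayFlow hD.rate
  have hβx : 0 ≤ β t₀ * ‖x₀‖ := mul_nonneg (hβ.pos t₀ h0).le (norm_nonneg _)
  have hflow : decayFlow hD.rate (V t₀ x₀) (t - t₀) ≤
      decayFlow hD.rate (a₂ (β t₀ * ‖x₀‖)) (t - t₀) :=
    (hkl.classK _ htt).mono.monotoneOn (hD.almostLip.nonneg t₀ h0 _) (ha₂.nonneg hβx)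
      (hup t₀ h0 x₀)
  have hζ0 : ∀ τ : Icc t₀ t, 0 ≤ ζ (δ τ * ‖v τ‖) := fun τ => hD.classN.nonneg
    (mul_nonneg (hD.weight.pos τ (h0.trans τ.2.1)).le (norm_nonneg _))
  have hζu0 : ∀ τ : Icc t₀ t, 0 ≤ ζᵤ (δᵤ τ * ‖u τ‖) := fun τ => hD.classN_u.nonneg
    (mul_nonneg (hD.weight_u.pos τ (h0.trans τ.2.1)).le (norm_nonneg _))
  have hv' := ha₁.inv_iSup_le hζ0 (hv.bddAbove hD.classN hD.weight h0 t)
  have hu' := ha₁.inv_iSup_le hζu0 (hu.bddAbove hD.classN_u hD.weight_u h0 t)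
  have n1 := ha₁.inv_nonneg (hkl.nonneg (ha₂.nonneg hβx) htt)
  have n2 : 0 ≤ ⨆ τ : Icc t₀ t, invKInf a₁ (ζ (δ τ * ‖v τ‖)) :=
    Real.iSup_nonneg fun τ => ha₁.inv_nonneg (hζ0 τ)
  have n3 : 0 ≤ ⨆ τ : Icc t₀ t, invKInf a₁ (ζᵤ (δᵤ τ * ‖u τ‖)) :=
    Real.iSup_nonneg fun τ => ha₁.inv_nonneg (hζu0 τ)
  have hH : ∀ c, V t (history r x t) ≤ c → ‖H t (history r x t)‖ ≤ invKInf a₁ c := fun c hc =>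
    (ha₁.le_inv_iff (norm_nonneg _) ((hD.almostLip.nonneg t h0t _).trans hc)).2
      ((hlow t h0t _).trans hc)
  rcases le_max_iff.1 hle with h | h
  · linarith [hH _ (h.trans hflow)]
  · rcases le_max_iff.1 h with h | h
    · linarith [hH _ h]
    · linarith [hH _ h]

/-! ### Forward completeness -/

/-- A bound for the current state along solutions. -/
theorem state_bound (hD : Dissipative D U S₂ f V ζ ζᵤ δ δᵤ ρ) (hsys : SystemHyp D U S₁ S₂ f H)
    {p μ : ℝ → ℝ} {R : ℝ}
    (hup : ∀ t, 0 ≤ t → ∀ x, V t x ≤ a₂ (β t * ‖x‖))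
    (hlow : ∀ t, 0 ≤ t → ∀ x : Hist r n, p (μ t * ‖x.now‖) ≤ V t x + R) {t₀ T S : ℝ} (h0 : 0 ≤ t₀)
    (hv : IsInput S₂ v) (hu : IsInput U u) (hd : IsInput D d) {x : C(ℝ, Vec n)}
    (hx : SolvesOn (fun t ξ => f t (d t) ξ (u t) (v t)) t₀ S x) (hS : S ≤ T) :
    ∀ t ∈ Icc t₀ S, p (μ t * ‖x t‖) ≤ max (a₂ (β t₀ * ‖history r x t₀‖))
      (max (⨆ τ : Icc t₀ T, ζ (δ τ * ‖v τ‖)) (⨆ τ : Icc t₀ T, ζᵤ (δᵤ τ * ‖u τ‖))) + R := by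
  intro t ht
  have htT := ht.2.trans hS
  have h := hD.le hsys h0 ht.1 hv hu hd (hx.mono ht)
  have hl := hlow t (h0.trans ht.1) (history r x t)
  rw [history_now] at hl
  refine hl.trans (add_le_add_left (h.trans (max_le_max ?_ (max_le_max ?_ ?_))) R)
  · exact (decayFlow_le hD.rate (hD.almostLip.nonneg t₀ h0 _) (sub_nonneg.2 ht.1)).trans
      (hup t₀ h0 _)
  · exact Real.iSup_le (fun τ => le_ciSup (hv.bddAbove hD.classN hD.weight h0 T)
      ⟨τ, τ.2.1, τ.2.2.trans htT⟩) (hD.iSup_nonneg h0 T)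
  · exact Real.iSup_le (fun τ => le_ciSup (hu.bddAbove hD.classN_u hD.weight_u h0 T)
      ⟨τ, τ.2.1, τ.2.2.trans htT⟩) (hD.iSup_u_nonneg h0 T)

/-- The a priori radius N₀ depends only on t₀, T, the initial history and the inputs, so it can be
fixed before truncating. A truncated solution solves the original equation until its history first
reaches norm N₀ + 1, but up to that time the a priori bound keeps the norm at most N₀. -/
theorem exists_solvesOn (hD : Dissipative D U S₂ f V ζ ζᵤ δ δᵤ ρ) (hsys : SystemHyp D U S₁ S₂ f H)
    (hup : ∀ t, 0 ≤ t → ∀ x, V t x ≤ a₂ (β t * ‖x‖))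
    {p μ : ℝ → ℝ} {R : ℝ} (hp : ClassKInf p) (hμ : ClassKPlus μ) (hR : 0 ≤ R)
    (hlow : ∀ t, 0 ≤ t → ∀ x : Hist r n, p (μ t * ‖x.now‖) ≤ V t x + R) {t₀ T : ℝ} (h0 : 0 ≤ t₀)
    (hT : t₀ ≤ T) (x₀ : Hist r n) (hv : IsInput S₂ v) (hu : IsInput U u) (hd : IsInput D d) :
    ∃ x : C(ℝ, Vec n), (∀ t ≤ t₀, x t = x₀.ext (t - t₀)) ∧
      SolvesOn (fun t ξ => f t (d t) ξ (u t) (v t)) t₀ T x := by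
  set M := max (a₂ (β t₀ * ‖x₀‖)) (max (⨆ τ : Icc t₀ T, ζ (δ τ * ‖v τ‖))
    (⨆ τ : Icc t₀ T, ζᵤ (δᵤ τ * ‖u τ‖))) + R
  have hM : 0 ≤ M := by
    refine add_nonneg (le_max_of_le_right (le_max_of_le_left ?_)) hR
    exact hD.iSup_nonneg h0 T
  obtain ⟨B, hB0, hB⟩ := exists_bound_Icc (φ := fun t => (μ t)⁻¹)
    (hμ.cont.inv₀ fun t ht => (hμ.pos t ht).ne') T
  have hQ := hp.inv_nonneg hM
  set N₀ := max ‖x₀‖ (invKInf p M * B)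
  have hN₀ : 0 ≤ N₀ := le_max_of_le_left (norm_nonneg _)
  obtain ⟨C, L, hF⟩ := hsys.boundedField_trunc h0 T (N₀ + 1) hv hu hd
  obtain ⟨x, hinit, hint⟩ := hF.exists_solution hT x₀
  have hx := hF.solvesOn_of_integral hT hint
  have hx0 : history r x t₀ = x₀ := by
    ext1 θ
    rw [history_apply, hinit _ (by linarith [θ.2.2]), add_sub_cancel_left, Hist.ext_apply]
  -- The endpoint S is excluded from the norm bound because a single time is null; at the first exit
  -- time the bound is known only strictly before S.
  have hsol : ∀ S ∈ Icc t₀ T, (∀ t ∈ Ico t₀ S, ‖history r x t‖ ≤ N₀ + 1) →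
      SolvesOn (fun t ξ => f t (d t) ξ (u t) (v t)) t₀ S x := by
    intro S hS hbd
    have hmono := hx.mono hS
    refine ⟨hmono.absCont, ?_⟩
    have hne : ∀ᵐ t : ℝ, t ≠ S := by simp [ae_iff]
    filter_upwards [hmono.ode, hne] with t ht htS htm
    have h1 := ht htm
    rwa [truncField_of_le ⟨htm.1, htm.2.trans hS.2⟩
      (hbd t ⟨htm.1, lt_of_le_of_ne htm.2 htS⟩)] at h1
  have hbound : ∀ t ∈ Icc t₀ T, ‖history r x t‖ < N₀ + 1 := by
    by_contra! hcon
    let A := Icc t₀ T ∩ (fun t => ‖history r x t‖) ⁻¹' Ici (N₀ + 1)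
    have hA : IsCompact A := isCompact_Icc.inter_right
      (isClosed_Ici.preimage (continuous_history x).norm)
    have hAne : A.Nonempty := by
      obtain ⟨t, ht, h⟩ := hcon
      exact ⟨t, ht, h⟩
    have hS := hA.sInf_mem hAne
    set S := sInf A
    have hSge : N₀ + 1 ≤ ‖history r x S‖ := hS.2
    have hsolS := hsol S hS.1 fun t ht => by
      by_contra! hlt
      exact absurd (csInf_le hA.bddBelow ⟨⟨ht.1, ht.2.le.trans hS.1.2⟩, hlt.le⟩) (not_le.2 ht.2)
    have hst := hD.state_bound hsys hup hlow h0 hv hu hd hsolS hS.1.2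
    rw [hx0] at hst
    have : ‖history r x S‖ ≤ N₀ := by
      refine norm_history_le hN₀ fun s hs => ?_
      rcases le_total s t₀ with h | h
      · rw [hinit s h]
        exact (x₀.norm_ext_le _).trans (le_max_left _ _)
      · refine le_max_of_le_right ?_
        have h0s := h0.trans h
        have hμs := hμ.pos s h0s
        have h1 := (hp.le_inv_iff (by positivity) hM).2 (hst s ⟨h, hs.2⟩)
        calc ‖x s‖ = μ s * ‖x s‖ * (μ s)⁻¹ := by field_simp
          _ ≤ invKInf p M * B :=
            mul_le_mul h1 (hB s ⟨h0s, hs.2.trans hS.1.2⟩) (by positivity) hQ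
    linarith
  exact ⟨x, hinit, hsol T ⟨hT, le_rfl⟩ fun t ht => (hbound t ⟨ht.1, ht.2.le⟩).le⟩

end Dissipative

/-- Solutions are unique. -/
theorem SystemHyp.eqOn_of_solvesOn (hsys : SystemHyp D U S₁ S₂ f H) {t₀ T : ℝ} (h0 : 0 ≤ t₀)
    (hv : IsInput S₂ v) (hu : IsInput U u) (hd : IsInput D d) {x y : C(ℝ, Vec n)}
    (hxy : EqOn x y (Iic t₀)) (hx : SolvesOn (fun t ξ => f t (d t) ξ (u t) (v t)) t₀ T x)
    (hy : SolvesOn (fun t ξ => f t (d t) ξ (u t) (v t)) t₀ T y) : EqOn x y (Iic T) := by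
  obtain ⟨N₁, hN₁⟩ := isCompact_Icc.exists_bound_of_continuousOn
    (continuous_history (r := r) x).continuousOn (s := Icc t₀ T)
  obtain ⟨N₂, hN₂⟩ := isCompact_Icc.exists_bound_of_continuousOn
    (continuous_history (r := r) y).continuousOn (s := Icc t₀ T)
  obtain ⟨C, L, hF⟩ := hsys.boundedField_trunc h0 T (max N₁ N₂) hv hu hd
  have htr : ∀ (z : C(ℝ, Vec n)), (∀ t ∈ Icc t₀ T, ‖history r z t‖ ≤ max N₁ N₂) →
      SolvesOn (fun t ξ => f t (d t) ξ (u t) (v t)) t₀ T z →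
      SolvesOn (truncField f t₀ T (max N₁ N₂) v u d) t₀ T z := by
    intro z hzN hz
    refine ⟨hz.absCont, ?_⟩
    filter_upwards [hz.ode] with t ht htm
    rw [truncField_of_le htm (hzN t htm)]
    exact ht htm
  have hx' := htr x (fun t ht => (hN₁ t ht).trans (le_max_left _ _)) hx
  have hy' := htr y (fun t ht => (hN₂ t ht).trans (le_max_right _ _)) hy
  intro t ht
  rcases le_total t t₀ with h | h
  · exact hxy h
  · have h1 := hF.norm_history_sub_le_exp hx' hy' ⟨h, ht⟩
    have h2 : history r x t₀ = history r y t₀ := history_congr fun s hs => hxy hs.2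
    rw [h2, sub_self, norm_zero, zero_mul, norm_le_zero_iff, sub_eq_zero] at h1
    rw [← history_now (r := r) x, ← history_now (r := r) y, h1]

theorem absCont_congr {X : Type*} [PseudoMetricSpace X] {g h : ℝ → X} {a b : ℝ}
    (hg : AbsolutelyContinuousOnInterval g a b) (heq : EqOn g h (uIcc a b)) :
    AbsolutelyContinuousOnInterval h a b := by
  rw [absolutelyContinuousOnInterval_iff] at hg ⊢
  intro ε hε
  obtain ⟨δ, hδ, H⟩ := hg ε hε
  refine ⟨δ, hδ, fun E hE hlt => lt_of_eq_of_lt (Finset.sum_congr rfl fun i hi => ?_) (H E hE hlt)⟩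
  have := hE.1 i hi
  rw [heq this.1, heq this.2]

/-- Solutions on all compact intervals can be glued together. -/
theorem SystemHyp.exists_isSolution (hsys : SystemHyp D U S₁ S₂ f H) {t₀ : ℝ} (h0 : 0 ≤ t₀)
    (x₀ : Hist r n) (hv : IsInput S₂ v) (hu : IsInput U u) (hd : IsInput D d)
    (hex : ∀ T, t₀ ≤ T → ∃ x : C(ℝ, Vec n), (∀ t ≤ t₀, x t = x₀.ext (t - t₀)) ∧
      SolvesOn (fun t ξ => f t (d t) ξ (u t) (v t)) t₀ T x) :
    ∃ x, IsSolution f t₀ x₀ v u d x := by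
  have hle : ∀ j : ℕ, t₀ ≤ t₀ + j := fun j => le_add_of_nonneg_right j.cast_nonneg
  choose X hXinit hX using fun j : ℕ => hex (t₀ + j) (hle j)
  have hone : ∀ i j : ℕ, i ≤ j → EqOn (X i) (X j) (Iic (t₀ + i)) := fun i j hij =>
    hsys.eqOn_of_solvesOn h0 hv hu hd
      (fun t ht => by rw [hXinit i t ht, hXinit j t ht]) (hX i)
      ((hX j).mono ⟨hle i, by gcongr⟩)
  -- The added 1 makes t < t₀ + N t strict, so the glued curve agrees with one fixed X (N t) in a
  -- neighbourhood of t and inherits its continuity and derivative.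
  let N : ℝ → ℕ := fun t => ⌈t - t₀⌉₊ + 1
  have hN : ∀ t, t < t₀ + N t := fun t => by
    have := Nat.le_ceil (t - t₀)
    simp only [N]
    push_cast
    linarith
  have hx : ∀ j : ℕ, EqOn (fun t => X (N t) t) (X j) (Iic (t₀ + j)) := by
    intro j t ht
    rcases le_total (N t) j with h | h
    · exact hone _ _ h (hN t).le
    · exact (hone _ _ h ht).symm
  have hev : ∀ t, (fun t => X (N t) t) =ᶠ[𝓝 t] X (N t) := fun t => by
    filter_upwards [Iio_mem_nhds (hN t)] with s hs using hx (N t) (mem_Iic.2 (mem_Iio.1 hs).le)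
  let x : C(ℝ, Vec n) := ⟨fun t => X (N t) t, continuous_iff_continuousAt.2 fun t =>
    (X (N t)).continuous.continuousAt.congr (hev t).symm⟩
  have hxinit : ∀ t ≤ t₀, x t = x₀.ext (t - t₀) := fun t ht => hXinit _ t ht
  refine ⟨x, ?_, fun T hT => ?_, ?_⟩
  · ext1 θ
    rw [history_apply, hxinit _ (by linarith [θ.2.2]), add_sub_cancel_left, Hist.ext_apply]
  · refine absCont_congr ((hX (N T)).mono ⟨hT, (hN T).le⟩).absCont fun t ht => ?_
    rw [uIcc_of_le hT] at ht
    exact (hx (N T) (ht.2.trans (hN T).le)).symm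
  · filter_upwards [ae_all_iff.2 fun j => (hX j).ode] with t ht htt
    have h1 := ht (N t) ⟨htt, (hN t).le⟩
    have h2 : history r x t = history r (X (N t)) t :=
      history_congr fun s hs => hx (N t) (hs.2.trans (hN t).le)
    rw [h2]
    exact h1.congr_of_eventuallyEq (hev t)

theorem Dissipative.forwardComplete {V : ℝ → Hist r n → ℝ} {ζ ζᵤ β δ δᵤ ρ a₂ : ℝ → ℝ}
    (hD : Dissipative D U S₂ f V ζ ζᵤ δ δᵤ ρ) (hsys : SystemHyp D U S₁ S₂ f H)
    (hup : ∀ t, 0 ≤ t → ∀ x, V t x ≤ a₂ (β t * ‖x‖))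
    {p μ : ℝ → ℝ} {R : ℝ} (hp : ClassKInf p) (hμ : ClassKPlus μ) (hR : 0 ≤ R)
    (hlow : ∀ t, 0 ≤ t → ∀ x : Hist r n, p (μ t * ‖x.now‖) ≤ V t x + R) :
    ForwardComplete D U S₂ f := fun _ h0 x₀ _ _ _ hv hu hd =>
  hsys.exists_isSolution h0 x₀ hv hu hd fun _ hT =>
    hD.exists_solvesOn hsys hup hp hμ hR hlow h0 hT x₀ hv hu hd

end RFDE

/-! ### Construction of the functions in the growth estimate -/

namespace RFDE

variable {r : ℝ≥0} {n l m k k₁ : ℕ}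

/-! ### The growth estimate -/

/-- The square of `p⁻¹ (2 s)`. -/
noncomputable def sqInv (p : ℝ → ℝ) (s : ℝ) : ℝ := invKInf p (2 * s) ^ 2

section SqInv

variable {p : ℝ → ℝ}

theorem sqInv_mono (hp : ClassKInf p) : MonotoneOn (sqInv p) (Ici 0) := fun s hs t ht hst => by
  have hs' : 0 ≤ 2 * s := mul_nonneg zero_le_two hs
  have ht' : 0 ≤ 2 * t := mul_nonneg zero_le_two ht
  exact pow_le_pow_left₀ (hp.inv_nonneg hs')
    (hp.inv_strictMonoOn.monotoneOn hs' ht' (by linarith)) 2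

theorem sqInv_zero (hp : ClassKInf p) : sqInv p 0 = 0 := by simp [sqInv, hp.inv_zero]

theorem sqInv_nonneg (p : ℝ → ℝ) (s : ℝ) : 0 ≤ sqInv p s := sq_nonneg _

theorem sqInv_continuousOn (hp : ClassKInf p) : ContinuousOn (sqInv p) (Ici 0) :=
  (hp.inv_continuousOn.comp (f := fun s => 2 * s) (s := Ici 0) (by fun_prop) fun s hs =>
    mem_Ici.2 (mul_nonneg zero_le_two (mem_Ici.1 hs))).pow 2

theorem classN_sqInv_comp (hp : ClassKInf p) {γ : ℝ → ℝ} (hγ : ClassN γ) :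
    ClassN fun s => sqInv p (γ s) where
  mono := fun s hs t ht hst => sqInv_mono hp (hγ.nonneg hs) (hγ.nonneg ht) (hγ.mono hs ht hst)
  zero := by simp [hγ.zero, sqInv_zero hp]

/-- The condition that `sqInv p` of g i is at most b amounts to 2 * g i ≤ p (√b), which is linear in
g i and so passes to the supremum. -/
theorem sqInv_iSup_le (hp : ClassKInf p) {ι : Type*} [Nonempty ι] {g : ι → ℝ}
    (h0 : ∀ i, 0 ≤ g i) (hb : BddAbove (range fun i => sqInv p (g i))) :
    sqInv p (⨆ i, g i) ≤ ⨆ i, sqInv p (g i) := by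
  set b := ⨆ i, sqInv p (g i)
  have hb0 : 0 ≤ b := Real.iSup_nonneg fun i => sqInv_nonneg _ _
  have hS : 0 ≤ ⨆ i, g i := Real.iSup_nonneg h0
  have key : ∀ i, 2 * g i ≤ p (√b) := fun i => by
    rw [← hp.inv_le_iff (Real.sqrt_nonneg _) (mul_nonneg zero_le_two (h0 i))]
    exact Real.le_sqrt_of_sq_le (le_ciSup hb i)
  have h2 : 2 * ⨆ i, g i ≤ p (√b) := by
    have : ⨆ i, g i ≤ p (√b) / 2 := ciSup_le fun i => by linarith [key i]
    linarith
  rw [← hp.inv_le_iff (Real.sqrt_nonneg _) (mul_nonneg zero_le_two hS)] at h2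
  exact (Real.le_sqrt (hp.inv_nonneg (mul_nonneg zero_le_two hS)) hb0).1 h2

/-- `p⁻¹` of a sum is controlled by the squares of its values at twice the summands. -/
theorem inv_add_le_sqrt (hp : ClassKInf p) {a b C : ℝ} (ha : 0 ≤ a) (hb : 0 ≤ b)
    (haC : sqInv p a ≤ C) (hbC : sqInv p b ≤ C) : invKInf p (a + b) ≤ √C := by
  rcases le_total a b with h | h
  · exact (hp.inv_strictMonoOn.monotoneOn (add_nonneg ha hb) (mul_nonneg zero_le_two hb)
      (by linarith)).trans (Real.le_sqrt_of_sq_le hbC)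
  · exact (hp.inv_strictMonoOn.monotoneOn (add_nonneg ha hb) (mul_nonneg zero_le_two ha)
      (by linarith)).trans (Real.le_sqrt_of_sq_le haC)

end SqInv

variable {D : Set (Vec l)} {U : Set (Vec m)} {S₁ : Set (Vec k₁)} {S₂ : Set (Vec k)}
  {f : ℝ → Vec l → Hist r n → Vec m → Vec k → Vec n} {H : ℝ → Hist r n → Vec k₁}
  {V : ℝ → Hist r n → ℝ} {ζ ζᵤ β δ δᵤ ρ a₂ φ p μ Φ : ℝ → ℝ} {R : ℝ}

/-- The part of the growth estimate that depends on the initial time. -/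
noncomputable def growthOffset (a₂ p Φ : ℝ → ℝ) (R t : ℝ) : ℝ :=
  Φ (2 * t) ^ 2 + sqInv p (a₂ (Φ t ^ 2)) + sqInv p R

/-- The part of the growth estimate that depends on the initial history. -/
noncomputable def growthGain (a₂ p : ℝ → ℝ) (s : ℝ) : ℝ := s ^ 2 + sqInv p (a₂ (s ^ 2))

theorem classKPlus_growthOffset (ha₂ : ClassKInf a₂) (hp : ClassKInf p) (hΦc : Continuous Φ)
    (hΦ1 : ∀ t, 0 ≤ t → 1 ≤ Φ t) (R : ℝ) : ClassKPlus (growthOffset a₂ p Φ R) where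
  cont := by
    refine ContinuousOn.add (ContinuousOn.add (by fun_prop) ?_) continuousOn_const
    refine (sqInv_continuousOn hp).comp (ha₂.cont.comp (by fun_prop)
      fun t _ => mem_Ici.2 (sq_nonneg (Φ t))) fun t _ => ha₂.nonneg (sq_nonneg _)
  pos t ht := by
    have := hΦ1 (2 * t) (by positivity)
    have := sqInv_nonneg p (a₂ (Φ t ^ 2))
    have := sqInv_nonneg p R
    unfold growthOffset
    positivity

theorem classN_growthGain (ha₂ : ClassKInf a₂) (hp : ClassKInf p) :
    ClassN (growthGain a₂ p) where
  mono s hs t ht hst := by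
    have h : s ^ 2 ≤ t ^ 2 := pow_le_pow_left₀ hs hst 2
    exact add_le_add h (sqInv_mono hp (ha₂.nonneg (sq_nonneg _)) (ha₂.nonneg (sq_nonneg _))
      (ha₂.mono.monotoneOn (mem_Ici.2 (sq_nonneg s)) (mem_Ici.2 (sq_nonneg t)) h))
  zero := by simp [growthGain, ha₂.zero, sqInv_zero hp]

/-- The product is at most c² or at most s², whichever of c and s is larger. This separates the
initial time from the initial history. -/
theorem sqInv_mul_le (ha₂ : ClassKInf a₂) (hp : ClassKInf p) {b c s : ℝ} (hb : 0 ≤ b) (hs : 0 ≤ s)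
    (hbc : b ≤ c) :
    sqInv p (a₂ (b * s)) ≤ max (sqInv p (a₂ (c ^ 2))) (sqInv p (a₂ (s ^ 2))) := by
  have hbs : 0 ≤ b * s := mul_nonneg hb hs
  have hmono : ∀ z, b * s ≤ z → sqInv p (a₂ (b * s)) ≤ sqInv p (a₂ z) := fun z hz =>
    sqInv_mono hp (ha₂.nonneg hbs) (ha₂.nonneg (hbs.trans hz))
      (ha₂.mono.monotoneOn hbs (hbs.trans hz) hz)
  rcases le_total c s with h | h
  · exact le_max_of_le_right (hmono _ (by nlinarith))
  · exact le_max_of_le_left (hmono _ (by nlinarith))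

/-- With C the right-hand side of the estimate, both Φ(t) and the bound on μ(s)|x(s)| are at most
√C. Since φ(t)/μ(s) ≤ Φ(t), multiplying gives C on [t₀, t]; before t₀ the second factor is replaced
by the norm of the initial history. -/
theorem Dissipative.growthEstimate (hD : Dissipative D U S₂ f V ζ ζᵤ δ δᵤ ρ)
    (hsys : SystemHyp D U S₁ S₂ f H) (ha₂ : ClassKInf a₂) (hβ : ClassKPlus β)
    (hup : ∀ t, 0 ≤ t → ∀ x, V t x ≤ a₂ (β t * ‖x‖)) (hp : ClassKInf p) (hμ : ClassKPlus μ)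
    (hR : 0 ≤ R) (hlow : ∀ t, 0 ≤ t → ∀ x : Hist r n, p (μ t * ‖x.now‖) ≤ V t x + R)
    (hδ : ∀ t, 0 ≤ t → δ t = 1) (hφ : ClassKPlus φ) (hΦm : MonotoneOn Φ (Ici 0))
    (hΦφ : ∀ t, 0 ≤ t → φ t ≤ Φ t) (hΦβ : ∀ t, 0 ≤ t → β t ≤ Φ t)
    (hΦμ : ∀ s t, 0 ≤ s → s ≤ t → φ t / μ s ≤ Φ t) :
    GrowthEstimate D U S₂ f φ δᵤ (fun t => Φ (2 * t) ^ 2) (growthOffset a₂ p Φ R)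
      (growthGain a₂ p) (fun s => sqInv p (ζ s)) (fun s => sqInv p (ζᵤ s)) := by
  intro t₀ h0 x₀ v u d hv hu hd x hx t ht
  have h0t := h0.trans ht
  have : Nonempty (Icc t₀ t) := ⟨⟨t₀, le_rfl, ht⟩⟩
  set C := max (Φ (2 * (t - t₀)) ^ 2) (max (growthOffset a₂ p Φ R t₀) (max (growthGain a₂ p ‖x₀‖)
    (max (⨆ τ : Icc t₀ t, sqInv p (ζ ‖v τ‖)) (⨆ τ : Icc t₀ t, sqInv p (ζᵤ (δᵤ τ * ‖u τ‖))))))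
    with hCdef
  have c1 : Φ (2 * (t - t₀)) ^ 2 ≤ C := le_max_left _ _
  have c2 : growthOffset a₂ p Φ R t₀ ≤ C := le_max_of_le_right (le_max_left _ _)
  have c3 : growthGain a₂ p ‖x₀‖ ≤ C := le_max_of_le_right (le_max_of_le_right (le_max_left _ _))
  have c4 : (⨆ τ : Icc t₀ t, sqInv p (ζ ‖v τ‖)) ≤ C :=
    le_max_of_le_right (le_max_of_le_right (le_max_of_le_right (le_max_left _ _)))
  have c5 : (⨆ τ : Icc t₀ t, sqInv p (ζᵤ (δᵤ τ * ‖u τ‖))) ≤ C :=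
    le_max_of_le_right (le_max_of_le_right (le_max_of_le_right (le_max_right _ _)))
  have hC : 0 ≤ C := (sq_nonneg _).trans c1
  have q1 := sqInv_nonneg p (a₂ (Φ t₀ ^ 2))
  have q2 := sqInv_nonneg p R
  have q3 := sqInv_nonneg p (a₂ (‖x₀‖ ^ 2))
  have q4 := sq_nonneg (Φ (2 * t₀))
  have q5 := sq_nonneg ‖x₀‖
  simp only [growthOffset] at c2
  simp only [growthGain] at c3
  have hφt := hφ.pos t h0t
  have hΦt : 0 < Φ t := hφt.trans_le (hΦφ t h0t)
  -- Since t = t₀ + (t - t₀) is at most twice the larger summand, the weight at t is controlled by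
  -- Φ(2(t - t₀)) or by Φ(2t₀).
  have hΦC : Φ t ≤ √C := by
    refine Real.le_sqrt_of_sq_le ?_
    rcases le_total t₀ (t - t₀) with h | h
    · refine le_trans (pow_le_pow_left₀ hΦt.le (hΦm h0t ?_ ?_) 2) c1
      · exact mul_nonneg zero_le_two (sub_nonneg.2 ht)
      · linarith
    · refine le_trans (pow_le_pow_left₀ hΦt.le (hΦm (b := 2 * t₀) h0t ?_ ?_) 2) (by linarith)
      · exact mul_nonneg zero_le_two h0
      · linarith
  have hx₀C : ‖x₀‖ ≤ √C := Real.le_sqrt_of_sq_le (by linarith)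
  have hinit : φ t * ‖x₀‖ ≤ C := by
    rw [← Real.mul_self_sqrt hC]
    exact mul_le_mul ((hΦφ t h0t).trans hΦC) hx₀C (norm_nonneg _) (Real.sqrt_nonneg _)
  have hζδ : ∀ τ : Icc t₀ t, ζ (δ τ * ‖v τ‖) = ζ ‖v τ‖ := fun τ => by
    rw [hδ τ (h0.trans τ.2.1), one_mul]
  have hX1 : sqInv p (a₂ (β t₀ * ‖x₀‖)) ≤ C :=
    (sqInv_mul_le ha₂ hp (hβ.pos t₀ h0).le (norm_nonneg _) (hΦβ t₀ h0)).trans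
      (max_le (by linarith) (by linarith))
  have hX2 : sqInv p (⨆ τ : Icc t₀ t, ζ (δ τ * ‖v τ‖)) ≤ C := by
    refine le_trans (sqInv_iSup_le hp (fun τ => ?_)
      (hv.bddAbove (classN_sqInv_comp hp hD.classN) hD.weight h0 t)) ?_
    · exact hD.classN.nonneg (mul_nonneg (hD.weight.pos τ (h0.trans τ.2.1)).le (norm_nonneg _))
    · simp_rw [hζδ]
      exact c4
  have hX3 : sqInv p (⨆ τ : Icc t₀ t, ζᵤ (δᵤ τ * ‖u τ‖)) ≤ C := by
    refine le_trans (sqInv_iSup_le hp (fun τ => ?_)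
      (hu.bddAbove (classN_sqInv_comp hp hD.classN_u) hD.weight_u h0 t)) c5
    exact hD.classN_u.nonneg (mul_nonneg (hD.weight_u.pos τ (h0.trans τ.2.1)).le (norm_nonneg _))
  set X := max (a₂ (β t₀ * ‖x₀‖)) (max (⨆ τ : Icc t₀ t, ζ (δ τ * ‖v τ‖))
    (⨆ τ : Icc t₀ t, ζᵤ (δᵤ τ * ‖u τ‖))) with hXdef
  have hX0 : 0 ≤ X := le_max_of_le_right (le_max_of_le_left (hD.iSup_nonneg h0 t))
  have hXC : sqInv p X ≤ C := by
    rcases max_choice (a₂ (β t₀ * ‖x₀‖)) (max (⨆ τ : Icc t₀ t, ζ (δ τ * ‖v τ‖))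
      (⨆ τ : Icc t₀ t, ζᵤ (δᵤ τ * ‖u τ‖))) with h | h
    · rw [hXdef, h]
      exact hX1
    · rw [hXdef, h]
      rcases max_choice (⨆ τ : Icc t₀ t, ζ (δ τ * ‖v τ‖))
        (⨆ τ : Icc t₀ t, ζᵤ (δᵤ τ * ‖u τ‖)) with h | h <;> rw [h]
      · exact hX2
      · exact hX3
  have hQ : invKInf p (X + R) ≤ √C := inv_add_le_sqrt hp hX0 hR hXC (by linarith)
  have hst := hD.state_bound hsys hup hlow h0 hv hu hd (hx.solvesOn ht) le_rfl
  rw [hx.init] at hst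
  rw [mul_comm, ← le_div_iff₀ hφt]
  refine norm_history_le (by positivity) fun s hs => ?_
  rw [le_div_iff₀ hφt, mul_comm]
  rcases le_total s t₀ with h | h
  · refine le_trans (mul_le_mul_of_nonneg_left ?_ hφt.le) hinit
    have := norm_le_norm_history (r := r) x (s := s) (t := t₀) ⟨by linarith [hs.1], h⟩
    rwa [hx.init] at this
  · have h0s := h0.trans h
    have hμs := hμ.pos s h0s
    have h1 := (hp.le_inv_iff (by positivity) (add_nonneg hX0 hR)).2 (hst s ⟨h, hs.2⟩)
    calc φ t * ‖x s‖ = φ t / μ s * (μ s * ‖x s‖) := by field_simp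
      _ ≤ √C * √C := mul_le_mul ((hΦμ s t h0s hs.2).trans hΦC) (h1.trans hQ) (by positivity)
          (Real.sqrt_nonneg _)
      _ = C := Real.mul_self_sqrt hC

/-- The case distinction serves the boundedness of c₁: under the uniform bounds Φ can be taken
constant, and otherwise it is assembled from monotone majorants of φ, β and 1/μ. The product of
those for φ and 1/μ dominates φ(t)/μ(s) because s ≤ t. -/
theorem exists_weight_majorant (hφ : ClassKPlus φ) (hβ : ClassKPlus β) (hμ : ClassKPlus μ) :
    ∃ Φ : ℝ → ℝ, Continuous Φ ∧ MonotoneOn Φ (Ici 0) ∧ (∀ t, 0 ≤ t → 1 ≤ Φ t) ∧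
      (∀ t, 0 ≤ t → φ t ≤ Φ t) ∧ (∀ t, 0 ≤ t → β t ≤ Φ t) ∧
      (∀ s t, 0 ≤ s → s ≤ t → φ t / μ s ≤ Φ t) ∧
      (BoundedOnHalfLine φ → (∃ L, 0 < L ∧ ∀ t, 0 ≤ t → β t + 1 / μ t ≤ L) → ∀ s t, Φ s = Φ t) := by
  by_cases h : BoundedOnHalfLine φ ∧ ∃ L, 0 < L ∧ ∀ t, 0 ≤ t → β t + 1 / μ t ≤ L
  · obtain ⟨⟨C, hC⟩, L, hL, hβμ⟩ := h
    have hC0 : 0 < C := (hφ.pos 0 le_rfl).trans_le (hC 0 le_rfl)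
    have hCL : 0 < C * L := by positivity
    have hβ0 := fun t ht => hβ.pos t ht
    have hμ0 : ∀ t, 0 ≤ t → 0 < 1 / μ t := fun t ht => one_div_pos.2 (hμ.pos t ht)
    refine ⟨fun _ => 1 + C + L + C * L, continuous_const, fun _ _ _ _ _ => le_rfl, ?_, ?_, ?_, ?_,
      fun _ _ _ _ => rfl⟩
    · intro t _; linarith
    · intro t ht; linarith [hC t ht]
    · intro t ht; linarith [hβμ t ht, hμ0 t ht]
    · intro s t hs hst
      have h1 : 1 / μ s ≤ L := by linarith [hβμ s hs, hβ0 s hs]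
      have h2 : φ t * (1 / μ s) ≤ C * L :=
        mul_le_mul (hC t (hs.trans hst)) h1 (hμ0 s hs).le hC0.le
      rw [div_eq_mul_one_div]
      linarith
  · obtain ⟨φ', hφc, hφm, hφφ⟩ := exists_monotone_majorant hφ.cont
    obtain ⟨b, hbc, hbm, hbb⟩ := exists_monotone_majorant hβ.cont
    obtain ⟨q, hqc, hqm, hqq⟩ := exists_monotone_majorant (φ := fun t => (μ t)⁻¹)
      (hμ.cont.inv₀ fun t ht => (hμ.pos t ht).ne')
    have hφ0 : ∀ t, 0 ≤ t → 0 < φ' t := fun t ht => (hφ.pos t ht).trans_le (hφφ t ht)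
    have hb0 : ∀ t, 0 ≤ t → 0 < b t := fun t ht => (hβ.pos t ht).trans_le (hbb t ht)
    have hq0 : ∀ t, 0 ≤ t → 0 < q t := fun t ht => (inv_pos.2 (hμ.pos t ht)).trans_le (hqq t ht)
    have hφq : ∀ t, 0 ≤ t → 0 < φ' t * q t := fun t ht => mul_pos (hφ0 t ht) (hq0 t ht)
    refine ⟨fun t => 1 + φ' t + b t + φ' t * q t, by fun_prop, ?_, ?_, ?_, ?_, ?_,
      fun h1 h2 => absurd ⟨h1, h2⟩ h⟩
    · intro s hs t ht hst
      have h1 := hφm hs ht hst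
      have h2 := hbm hs ht hst
      have h3 := mul_le_mul h1 (hqm hs ht hst) (hq0 s hs).le (hφ0 t ht).le
      simp only
      linarith
    · intro t ht; linarith [hφ0 t ht, hb0 t ht, hφq t ht]
    · intro t ht; linarith [hφφ t ht, hb0 t ht, hφq t ht]
    · intro t ht; linarith [hbb t ht, hφ0 t ht, hφq t ht]
    · intro s t hs hst
      have ht := hs.trans hst
      have h1 : φ t * (μ s)⁻¹ ≤ φ' t * q t :=
        mul_le_mul (hφφ t ht) ((hqq s hs).trans (hqm hs ht hst))
          (inv_nonneg.2 (hμ.pos s hs).le) (hφ0 t ht).le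
      rw [div_eq_mul_inv]
      linarith [hφ0 t ht, hb0 t ht]

end RFDE

/-! ### Assembly of the two assertions -/

theorem theorem3p3 (r : ℝ≥0) (n l m k₁ k : ℕ)
    (D : Set (RFDE.Vec l)) (U : Set (RFDE.Vec m)) (S₁ : Set (RFDE.Vec k₁)) (S₂ : Set (RFDE.Vec k))
    (f : ℝ → RFDE.Vec l → RFDE.Hist r n → RFDE.Vec m → RFDE.Vec k → RFDE.Vec n)
    (H : ℝ → RFDE.Hist r n → RFDE.Vec k₁)
    (hsys : RFDE.SystemHyp D U S₁ S₂ f H)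
    (V : ℝ → RFDE.Hist r n → ℝ) (hV : RFDE.AlmostLipschitz V)
    (a₂ ζ ζᵤ β δ δᵤ ρ : ℝ → ℝ)
    (ha₂ : RFDE.ClassKInf a₂) (hζ : RFDE.ClassN ζ) (hζᵤ : RFDE.ClassN ζᵤ)
    (hβ : RFDE.ClassKPlus β) (hδ : RFDE.ClassKPlus δ) (hδᵤ : RFDE.ClassKPlus δᵤ)
    (hρ : RFDE.ContPosDef ρ)
    (hVupper : ∀ t, 0 ≤ t → ∀ x, V t x ≤ a₂ (β t * ‖x‖))
    (hVdecay : ∀ t, 0 ≤ t → ∀ x, ∀ u ∈ U, ∀ v ∈ S₂, ∀ d ∈ D,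
      max (ζ (δ t * ‖v‖)) (ζᵤ (δᵤ t * ‖u‖)) ≤ V t x →
        RFDE.genDeriv V t x (f t d x u v) ≤ ((-ρ (V t x) : ℝ) : EReal)) :
    -- the output estimate
    (∀ a₁ : ℝ → ℝ, RFDE.ClassKInf a₁ →
      (∀ t, 0 ≤ t → ∀ x, a₁ ‖H t x‖ ≤ V t x) →
      RFDE.ForwardComplete D U S₂ f →
      (∃ μ₁ c₁ φ g₁ p₁ p₁ᵤ : ℝ → ℝ,
        RFDE.ClassKPlus μ₁ ∧ RFDE.ClassKPlus c₁ ∧ RFDE.ClassKPlus φ ∧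
        RFDE.ClassN g₁ ∧ RFDE.ClassN p₁ ∧ RFDE.ClassN p₁ᵤ ∧
        RFDE.GrowthEstimate D U S₂ f φ δᵤ μ₁ c₁ g₁ p₁ p₁ᵤ) →
      ∃ σ₁ : ℝ → ℝ → ℝ, RFDE.ClassKL σ₁ ∧
        RFDE.OutputEstimate D U S₂ f H σ₁ β
          (fun s => RFDE.invKInf a₁ (ζ s)) δ (fun s => RFDE.invKInf a₁ (ζᵤ s)) δᵤ) ∧
    -- forward completeness and the growth estimate
    (∀ (p μ : ℝ → ℝ) (R : ℝ), RFDE.ClassKInf p → RFDE.ClassKPlus μ → 0 ≤ R →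
      (∀ t, 0 ≤ t → ∀ x : RFDE.Hist r n, p (μ t * ‖x.now‖) ≤ V t x + R) →
      (∀ t, 0 ≤ t → δ t = 1) →
      RFDE.ForwardComplete D U S₂ f ∧
      ∀ φ : ℝ → ℝ, RFDE.ClassKPlus φ →
        ∃ μ₁ c₁ g₁ p₁ p₁ᵤ : ℝ → ℝ,
          RFDE.ClassKPlus μ₁ ∧ RFDE.ClassKPlus c₁ ∧
          RFDE.ClassN g₁ ∧ RFDE.ClassN p₁ ∧ RFDE.ClassN p₁ᵤ ∧
          RFDE.GrowthEstimate D U S₂ f φ δᵤ μ₁ c₁ g₁ p₁ p₁ᵤ ∧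
          (RFDE.BoundedOnHalfLine φ → (∃ L, 0 < L ∧ ∀ t, 0 ≤ t → β t + 1 / μ t ≤ L) →
            RFDE.BoundedOnHalfLine c₁)) := by
  have hD : RFDE.Dissipative D U S₂ f V ζ ζᵤ δ δᵤ ρ := ⟨hV, hζ, hζᵤ, hδ, hδᵤ, hρ, hVdecay⟩
  refine ⟨fun a₁ ha₁ hlow _ _ => ?_, fun p μ R hp hμ hR hlow hδ1 => ⟨?_, fun φ hφ => ?_⟩⟩
  -- The function σ₁(s, t) is a₁⁻¹ of the decay flow started at a₂(s).
  · exact ⟨_, (RFDE.classKL_decayFlow hρ).conj ha₁.classK_inv ha₂.toClassK,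
      hD.outputEstimate hsys ha₂ hβ hVupper ha₁ hlow⟩
  · exact hD.forwardComplete hsys hVupper hp hμ hR hlow
  · obtain ⟨Φ, hΦc, hΦm, hΦ1, hΦφ, hΦβ, hΦμ, hconst⟩ := RFDE.exists_weight_majorant hφ hβ hμ
    refine ⟨_, _, _, _, _, ⟨?_, fun t ht => ?_⟩, RFDE.classKPlus_growthOffset ha₂ hp hΦc hΦ1 R,
      RFDE.classN_growthGain ha₂ hp, RFDE.classN_sqInv_comp hp hζ, RFDE.classN_sqInv_comp hp hζᵤ,
      hD.growthEstimate hsys ha₂ hβ hVupper hp hμ hR hlow hδ1 hφ hΦm hΦφ hΦβ hΦμ,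
      fun hb hL => ⟨RFDE.growthOffset a₂ p Φ R 0, fun t _ => ?_⟩⟩
    · fun_prop
    · have := hΦ1 (2 * t) (by positivity)
      positivity
    -- Here Φ is constant, so the offset c₁ is constant as well and is bounded by its value at 0.
    · rw [RFDE.growthOffset, RFDE.growthOffset, hconst hb hL (2 * t) (2 * 0), hconst hb hL t 0]
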